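/- **Setting.** Consider a sequence of linear models $y=X\beta^*+\varepsilon$ (the index of the sequence is suppressed) with sample size $N\to\infty$, dimension $n\ge 2$, $X\in\mathbb{R}^{N\times n}$, $\beta^*\in\mathbb{R}^n$, and a graph $\mathcal G$ with vertex set $[n]$ and maximum degree $d$; $n$, $\mathcal G$, $\beta^*$ and all quantities below may vary along the sequence unless they are called constants. Let $F$ be the oriented incidence matrix of $\mathcal G$ (the row of the edge $(i,j)$, $i<j$, has $-1$ in entry $i$, $+1$ in entry $j$, and zeros elsewhere), $L=F^TF$, and for a fixed integer $k\ge 0$ let $\Delta^{(k+1)}=L^{(k+1)/2}$ if $k$ is odd and $\Delta^{(k+1)}=FL^{k/2}$ if $k$ is even. Let $s_1,s_2>0$ and assume $\|\Delta^{(k+1)}\beta^*\|_0\le s_1$ and $\|\beta^*\|_0\le s_2$, where $\|\cdot\|_0$ counts nonzero entries. The rows of $X$ are i.i.d. $\sigma_x$-sub-Gaussian random vectors with covariance matrix $\Sigma_x$: they have mean zero, and $\mathbb{E}\,e^{t\,u^TX_i}\le e^{\sigma_x^2t^2/2}$ for all $t\in\mathbb{R}$ and all Euclidean unit vectors $u$.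 All eigenvalues of $\Sigma_x$ lie in $[c,c']$, where $\sigma_x,c,c'>0$ are constants. Put $\Theta_x=\Sigma_x^{-1}$ and assume $\max_a\sum_b|(\Theta_x)_{ab}|\le M_n$. The noise satisfies $\varepsilon\sim N(0,\sigma_\varepsilon^2I_N)$ with $\sigma_\varepsilon>0$ and is independent of $X$. **Estimators.** Let $\Sigma_N=\frac1N X^TX$, let $$\hat\beta\in\arg\min_{\beta\in\mathbb{R}^n}\ \frac1{2N}\|y-X\beta\|_2^2+\lambda_g\|\Delta^{(k+1)}\beta\|_1+\lambda\|\beta\|_1 ,$$ and let $\widehat\Theta$, a measurable function of $X$, be a minimizer of $\sum_{a,b}|\Theta_{ab}|$ over all $\Theta\in\mathbb{R}^{n\times n}$ with $\max_{a,b}|(\Theta\Sigma_N-I_n)_{ab}|\le\mu$ (an arbitrary value is taken when no such $\Theta$ exists). Let $$\tilde\beta=\hat\beta+\frac1N\widehat\Theta X^T(y-X\hat\beta),\qquad \hat\sigma_\varepsilon=\sqrt{\frac1N\sum_{i=1}^N\left(y_i-X_i^T\hat\beta\right)^2}.$$ **Statement.** There are constants $c_\lambda,c_\mu>0$, depending only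 on $\sigma_x,c,c'$, such that the following holds. Let $\lambda\asymp\sigma_\varepsilon\sqrt{\log n/N}$ and $\mu\asymp\sqrt{\log n/N}$ with sufficiently large constants, that is, for some constants $C_\lambda,C_\mu$, $$c_\lambda\,\sigma_\varepsilon\sqrt{\tfrac{\log n}{N}}\le\lambda\le C_\lambda\,\sigma_\varepsilon\sqrt{\tfrac{\log n}{N}},\qquad c_\mu\sqrt{\tfrac{\log n}{N}}\le\mu\le C_\mu\sqrt{\tfrac{\log n}{N}},$$ and let $\lambda_g=\lambda\sqrt{\nu/(2d)^{k+1}}$ for a constant $0\le\nu<1$ (with $\lambda_g=0$ if $d=0$). Assume $$\frac{s_2}{s_1}\ge\nu,\qquad \frac{s_2\log n}{\sqrt N}\to0,\qquad M_n\sqrt{\frac{\log n}{N}}\to0 .$$ Then for every choice of coordinates $j\in[n]$ (which may vary along the sequence), $$\frac{\sqrt N\,(\tilde\beta_j-\beta_j^*)}{\hat\sigma_\varepsilon\sqrt{e_j^T\widehat\Theta\,\Sigma_N\widehat\Theta^Te_j}}\ \longrightarrow\ N(0,1)\quad\text{in distribution}.$$ -/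

import Mathlib

open MeasureTheory ProbabilityTheory Filter Topology Matrix

namespace GraphLasso

noncomputable section

/-! Graph difference operators on a graph with vertex set `Fin n`. -/

/-- The edges of `G`, each written as `(i, j)` with `i < j`. -/
abbrev Edge {n : ℕ} (G : SimpleGraph (Fin n)) : Type :=
  {p : Fin n × Fin n // p.1 < p.2 ∧ G.Adj p.1 p.2}

instance edgeFintype {n : ℕ} (G : SimpleGraph (Fin n)) : Fintype (Edge G) := by
  classical
  infer_instance

/-- The oriented incidence matrix `F`: the row of the edge `(i, j)`, `i < j`, has `-1` in entry
`i`, `+1` in entry `j`, and zeros elsewhere. -/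
def incidence {n : ℕ} (G : SimpleGraph (Fin n)) : Matrix (Edge G) (Fin n) ℝ :=
  fun e v => if v = e.1.1 then -1 else if v = e.1.2 then 1 else 0

/-- The Laplacian matrix `L = FᵀF`. -/
def laplacian {n : ℕ} (G : SimpleGraph (Fin n)) : Matrix (Fin n) (Fin n) ℝ :=
  (incidence G)ᵀ * incidence G

/-- Row index type of a graph difference operator: the vertices if the flag `odd` is `true`,
the edges if it is `false`. -/
def DiffRow {n : ℕ} (G : SimpleGraph (Fin n)) : (odd : Bool) → Type
  | true => Fin n
  | false => Edge G

instance diffRowFintype {n : ℕ} (G : SimpleGraph (Fin n)) :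
    (odd : Bool) → Fintype (DiffRow G odd)
  | true => inferInstanceAs (Fintype (Fin n))
  | false => inferInstanceAs (Fintype (Edge G))

/-- `L ^ ((k + 1) / 2)` for the flag `true`, and `F * L ^ (k / 2)` for the flag `false`. -/
def diffMatrix {n : ℕ} (G : SimpleGraph (Fin n)) (k : ℕ) :
    (odd : Bool) → Matrix (DiffRow G odd) (Fin n) ℝ
  | true => (laplacian G ^ ((k + 1) / 2) : Matrix (Fin n) (Fin n) ℝ)
  | false => (incidence G * laplacian G ^ (k / 2) : Matrix (Edge G) (Fin n) ℝ)

/-- The graph difference operator `Δ^(k+1)` of order `k + 1`: it is `L ^ ((k + 1) / 2)` for odd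
`k` and `F * L ^ (k / 2)` for even `k`. -/
def graphDiff {n : ℕ} (G : SimpleGraph (Fin n)) (k : ℕ) :
    Matrix (DiffRow G (decide (Odd k))) (Fin n) ℝ :=
  diffMatrix G k (decide (Odd k))

/-- The maximum degree of the graph, as a real number. -/
def maxDeg {n : ℕ} (G : SimpleGraph (Fin n)) : ℝ := by
  classical
  exact (G.maxDegree : ℝ)

/-- The `ℓ₁`-norm of a vector. -/
def l1 {ι : Type} [Fintype ι] (v : ι → ℝ) : ℝ := ∑ i, |v i|

/-- The number of nonzero entries of a vector. -/
def l0 {ι : Type} (v : ι → ℝ) : ℕ := (Function.support v).ncard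

/-- The parameter space `S(k, s₁, s₂)`. -/
def paramSpace {n : ℕ} (G : SimpleGraph (Fin n)) (k : ℕ) (s₁ s₂ : ℝ) : Set (Fin n → ℝ) :=
  {b | (l0 (graphDiff G k *ᵥ b) : ℝ) ≤ s₁ ∧ (l0 b : ℝ) ≤ s₂}

/-! The random design and the noise. -/

/-- A real random variable is `σ`-sub-Gaussian: it has mean zero and
`E exp (t Y) ≤ exp (σ² t² / 2)` for all real `t`. -/
def IsSubGaussian {Ω : Type*} [MeasurableSpace Ω] (σ : ℝ) (Y : Ω → ℝ) (P : Measure Ω) : Prop :=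
  ∫ ω, Y ω ∂P = 0 ∧ HasSubgaussianMGF Y (Real.toNNReal (σ ^ 2)) P

/-- A random vector is `σ`-sub-Gaussian: it has mean zero and all its projections on Euclidean
unit vectors are `σ`-sub-Gaussian. -/
def IsSubGaussianVec {Ω : Type*} [MeasurableSpace Ω] {n : ℕ} (σ : ℝ) (Y : Ω → Fin n → ℝ)
    (P : Measure Ω) : Prop :=
  (∀ a, ∫ ω, Y ω a ∂P = 0) ∧
    ∀ u : Fin n → ℝ, ∑ a, u a ^ 2 = 1 → IsSubGaussian σ (fun ω => ∑ a, u a * Y ω a) P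

/-- `X` is a row-wise `(σ, S)`-sub-Gaussian random matrix: its rows are i.i.d., `σ`-sub-Gaussian,
with covariance matrix `S`. -/
structure IsSubGaussianDesign {Ω : Type*} [MeasurableSpace Ω] {N n : ℕ} (σ : ℝ)
    (S : Matrix (Fin n) (Fin n) ℝ) (X : Ω → Fin N → Fin n → ℝ) (P : Measure Ω) : Prop where
  measurable : Measurable X
  indep : iIndepFun (fun (i : Fin N) (ω : Ω) => X ω i) P
  ident : ∀ i i' : Fin N, IdentDistrib (fun ω => X ω i) (fun ω => X ω i') P P
  subGaussian : ∀ i : Fin N, IsSubGaussianVec σ (fun ω => X ω i) P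
  covariance : ∀ (i : Fin N) (a b : Fin n), cov[fun ω => X ω i a, fun ω => X ω i b; P] = S a b

/-- The noise vector is `N(0, σ² I_N)`: its components are i.i.d. `N(0, σ²)`. -/
structure IsGaussianNoise {Ω : Type*} [MeasurableSpace Ω] {N : ℕ} (σ : ℝ)
    (ε : Ω → Fin N → ℝ) (P : Measure Ω) : Prop where
  indep : iIndepFun (fun (i : Fin N) (ω : Ω) => ε ω i) P
  law : ∀ i : Fin N, HasLaw (fun ω => ε ω i) (gaussianReal 0 (Real.toNNReal (σ ^ 2))) P

/-! The estimators. -/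

/-- The response `y = X β + ε` of the linear model. -/
def response {N n : ℕ} (X : Matrix (Fin N) (Fin n) ℝ) (β : Fin n → ℝ) (ε : Fin N → ℝ) :
    Fin N → ℝ :=
  X *ᵥ β + ε

/-- The objective `(1 / (2N)) ‖y - X b‖₂² + λ_g ‖Δ^(k+1) b‖₁ + λ ‖b‖₁`. -/
def objective {N n : ℕ} (G : SimpleGraph (Fin n)) (k : ℕ) (lamg lam : ℝ)
    (X : Matrix (Fin N) (Fin n) ℝ) (y : Fin N → ℝ) (b : Fin n → ℝ) : ℝ :=
  1 / (2 * (N : ℝ)) * ∑ i, (y i - (X *ᵥ b) i) ^ 2 + lamg * l1 (graphDiff G k *ᵥ b) + lam * l1 b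

/-- `b` is a `k`-th order Graph-Piecewise-Polynomial-Lasso estimate, that is, a global minimizer
of the objective. -/
def IsGraphLasso {N n : ℕ} (G : SimpleGraph (Fin n)) (k : ℕ) (lamg lam : ℝ)
    (X : Matrix (Fin N) (Fin n) ℝ) (y : Fin N → ℝ) (b : Fin n → ℝ) : Prop :=
  ∀ b' : Fin n → ℝ, objective G k lamg lam X y b ≤ objective G k lamg lam X y b'

/-- `Σ_N = (1 / N) XᵀX`. -/
def sampleCov {N n : ℕ} (X : Matrix (Fin N) (Fin n) ℝ) : Matrix (Fin n) (Fin n) ℝ :=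
  (1 / (N : ℝ)) • (Xᵀ * X)

/-- The CLIME constraint: all entries of `Θ Σ_N - I` are at most `mu` in absolute value. -/
def ClimeFeasible {N n : ℕ} (X : Matrix (Fin N) (Fin n) ℝ) (mu : ℝ)
    (Θ : Matrix (Fin n) (Fin n) ℝ) : Prop :=
  ∀ a b, |(Θ * sampleCov X - 1) a b| ≤ mu

/-- `Θ` solves the CLIME program: it minimizes the elementwise `ℓ₁`-norm subject to the
constraint. -/
def IsClime {N n : ℕ} (X : Matrix (Fin N) (Fin n) ℝ) (mu : ℝ)
    (Θ : Matrix (Fin n) (Fin n) ℝ) : Prop :=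
  ClimeFeasible X mu Θ ∧
    ∀ Θ' : Matrix (Fin n) (Fin n) ℝ, ClimeFeasible X mu Θ' →
      ∑ a, ∑ b, |Θ a b| ≤ ∑ a, ∑ b, |Θ' a b|

/-- The one-step estimator `b + (1 / N) Θ Xᵀ (y - X b)`. -/
def oneStep {N n : ℕ} (X : Matrix (Fin N) (Fin n) ℝ) (y : Fin N → ℝ)
    (Θ : Matrix (Fin n) (Fin n) ℝ) (b : Fin n → ℝ) : Fin n → ℝ :=
  b + (1 / (N : ℝ)) • (Θ *ᵥ (Xᵀ *ᵥ (y - X *ᵥ b)))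

/-- The residual estimator of the noise standard deviation. -/
def residualStd {N n : ℕ} (X : Matrix (Fin N) (Fin n) ℝ) (y : Fin N → ℝ) (b : Fin n → ℝ) : ℝ :=
  √(1 / (N : ℝ) * ∑ i, (y i - (X *ᵥ b) i) ^ 2)

/-- The studentized statistic
`√N (β̃_j - β_j) / (σ̂ √(e_jᵀ Θ Σ_N Θᵀ e_j))` of the one-step estimator `β̃` built from the
initial estimate `b`, where `σ̂` is the residual estimator. -/
def studentized {N n : ℕ} (X : Matrix (Fin N) (Fin n) ℝ) (y : Fin N → ℝ)
    (Θ : Matrix (Fin n) (Fin n) ℝ) (b β : Fin n → ℝ) (j : Fin n) : ℝ :=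
  √(N : ℝ) * (oneStep X y Θ b j - β j) /
    (residualStd X y b * √((Θ * sampleCov X * Θᵀ) j j))

end

end GraphLasso

open GraphLasso

namespace GraphLasso

/-! ### Sub-exponential concentration -/

/-! Debiasing splits the error exactly: by `oneStep_sub`, β̃ - β* equals (1/N) Θ̂ Xᵀ ε minus (Θ̂ Σ_N
- I)(β̂ - β*). Since Θ̂ is a function of X alone and ε is independent of X, coordinate j of the
first term, normalized by σ_ε √((Θ̂ Σ_N Θ̂ᵀ)_jj / N), is exactly standard Gaussian for every sample
size (`hasLaw_leadingTerm`). No central limit theorem is needed: it remains to show that the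
statistic differs from this leading term by o(1) in probability, which suffices by
`tendstoInDistribution_of_close`.

The CLIME constraint bounds the second term by μ ‖β̂ - β*‖₁. The Lasso rate ‖β̂ - β*‖₁ ≲ σ_ε s₂
√(log n / N) makes √N times it of order σ_ε s₂ log n / √N. The normalization does not degenerate,
because feasibility and Cauchy-Schwarz bound (Θ̂ Σ_N Θ̂ᵀ)_jj below, and σ̂_ε / σ_ε tends to 1 by the
prediction error bound and the concentration of the noise variance.

In the Lasso analysis (`lasso_error_bound`) the graph penalty is only a perturbation: ‖Δ^(k+1)‖² ≤
(2d)^(k+1) and ν s₁ ≤ s₂ bound its contribution by λ √s₂ ‖β̂ - β*‖₂ (`graph_penalty_le`). The error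
then lies in a cone ‖h‖₁ ≤ 6 √s ‖h‖₂, where entrywise closeness of Σ_N to Σ_x yields a restricted
eigenvalue. The entrywise bounds come from a Bernstein inequality for products of sub-Gaussian
variables (`exists_bernstein_mul`).

The dimension need not tend to infinity, so failure probabilities of order 1/n need not vanish,
while c_λ and c_μ must stay fixed. For a target probability δ, dimensions above a cutoff K of order
1/δ have small enough failure probability. Below K, the number n itself serves as the sparsity
level, so λ need not dominate the noise, and Σ_N is invertible, so CLIME is feasible whatever μ ≥ 0
is. -/

theorem exp_le_one_add_add_sq_mul_exp_abs (x : ℝ) :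
    Real.exp x ≤ 1 + x + x ^ 2 * Real.exp |x| := by
  have h1 : 1 ≤ Real.exp |x| := Real.one_le_exp (abs_nonneg x)
  have h2 : x ^ 2 ≤ x ^ 2 * Real.exp |x| := le_mul_of_one_le_right (sq_nonneg x) h1
  rcases le_total |x| 1 with h | h
  · have := (abs_le.1 (Real.abs_exp_sub_one_sub_id_le h)).2
    linarith
  · rcases le_total 0 x with hx | hx
    · rw [abs_of_nonneg hx] at h ⊢
      have : Real.exp x ≤ x ^ 2 * Real.exp x :=
        le_mul_of_one_le_left (Real.exp_pos x).le (by nlinarith)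
      linarith
    · rw [abs_of_nonpos hx] at h
      have : Real.exp x ≤ 1 := Real.exp_le_one_iff.2 hx
      nlinarith

theorem sq_le_mul_exp_half {y : ℝ} (hy : 0 ≤ y) : y ^ 2 ≤ 8 * Real.exp (y / 2) := by
  have := Real.quadratic_le_exp_of_nonneg (x := y / 2) (by linarith)
  nlinarith

/-- As |s| ≤ a / 2, half of the exponent a|x| absorbs exp |s x| and the other half absorbs x². The
explicit s² makes the resulting moment generating function bound quadratic in s. -/
theorem sq_mul_exp_le {a s x : ℝ} (ha : 0 < a) (hs : |s| ≤ a / 2) :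
    (s * x) ^ 2 * Real.exp |s * x| ≤ 8 / a ^ 2 * s ^ 2 * Real.exp (a * |x|) := by
  have h1 : |s * x| ≤ a * |x| / 2 := by
    rw [abs_mul]; nlinarith [abs_nonneg x]
  have h2 := sq_le_mul_exp_half (y := a * |x|) (by positivity)
  have h3 : x ^ 2 ≤ 8 / a ^ 2 * Real.exp (a * |x| / 2) := by
    rw [div_mul_eq_mul_div, le_div_iff₀ (by positivity)]
    calc x ^ 2 * a ^ 2 = (a * |x|) ^ 2 := by rw [mul_pow, sq_abs]; ring
      _ ≤ _ := h2
  calc (s * x) ^ 2 * Real.exp |s * x|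
      ≤ (s ^ 2 * (8 / a ^ 2 * Real.exp (a * |x| / 2))) * Real.exp (a * |x| / 2) := by
        rw [mul_pow]
        gcongr
    _ = 8 / a ^ 2 * s ^ 2 * (Real.exp (a * |x| / 2) * Real.exp (a * |x| / 2)) := by ring
    _ = _ := by rw [← Real.exp_add]; ring_nf

section MGF

variable {Ω : Type*} [MeasurableSpace Ω] {P : Measure Ω} [IsProbabilityMeasure P]

/-- A random variable with an exponential absolute moment has, after centering, a moment generating
function of sub-Gaussian type near the origin. -/
theorem mgf_centered_le {W : Ω → ℝ} {a K : ℝ} (ha : 0 < a) (hW : AEMeasurable W P)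
    (hint : Integrable (fun ω => Real.exp (a * |W ω|)) P)
    (hK : ∫ ω, Real.exp (a * |W ω|) ∂P ≤ K) {s : ℝ} (hs : |s| ≤ a / 2) :
    Integrable (fun ω => Real.exp (s * (W ω - P[W]))) P ∧
      mgf (fun ω => W ω - P[W]) P s ≤ Real.exp (8 * K * Real.exp K / a ^ 2 * s ^ 2) := by
  set m := P[W] with hm
  have hWint : Integrable W P := by
    refine Integrable.mono' (hint.const_mul (1 / a)) hW.aestronglyMeasurable
      (Eventually.of_forall fun ω => ?_)
    have := Real.add_one_le_exp (a * |W ω|)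
    rw [Real.norm_eq_abs, div_mul_eq_mul_div, le_div_iff₀ ha]
    nlinarith
  -- Since a|W| ≤ exp (a|W|), the mean is at most K / a, so centering costs only the factor exp K.
  have hmK : a * |m| ≤ K := by
    have h1 : |m| ≤ ∫ ω, |W ω| ∂P := abs_integral_le_integral_abs
    have h2 : a * ∫ ω, |W ω| ∂P ≤ ∫ ω, Real.exp (a * |W ω|) ∂P := by
      rw [← integral_const_mul]
      refine integral_mono (hWint.abs.const_mul a) hint fun ω => ?_
      have := Real.add_one_le_exp (a * |W ω|)
      simp only
      linarith
    nlinarith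
  have hbd : ∀ ω, Real.exp (a * |W ω - m|) ≤ Real.exp K * Real.exp (a * |W ω|) := by
    intro ω
    rw [← Real.exp_add, Real.exp_le_exp]
    have := abs_sub (W ω) m
    nlinarith
  have hint' : Integrable (fun ω => Real.exp (a * |W ω - m|)) P := by
    refine Integrable.mono' (hint.const_mul (Real.exp K)) (by fun_prop)
      (Eventually.of_forall fun ω => ?_)
    rw [Real.norm_eq_abs, abs_of_pos (Real.exp_pos _)]
    exact hbd ω
  have hints : Integrable (fun ω => Real.exp (s * (W ω - m))) P := by
    refine Integrable.mono' hint' (by fun_prop) (Eventually.of_forall fun ω => ?_)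
    rw [Real.norm_eq_abs, abs_of_pos (Real.exp_pos _), Real.exp_le_exp]
    calc s * (W ω - m) ≤ |s| * |W ω - m| := by rw [← abs_mul]; exact le_abs_self _
      _ ≤ a * |W ω - m| := by gcongr; linarith
  refine ⟨hints, ?_⟩
  have hcint : Integrable (fun ω => W ω - m) P := hWint.sub (integrable_const m)
  have hc0 : ∫ ω, (W ω - m) ∂P = 0 := by
    rw [integral_sub hWint (integrable_const m)]; simp [hm]
  calc mgf (fun ω => W ω - m) P s
      ≤ ∫ ω, (1 + s * (W ω - m) + 8 / a ^ 2 * s ^ 2 * Real.exp (a * |W ω - m|)) ∂P := by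
        refine integral_mono hints
          (((integrable_const 1).add (hcint.const_mul s)).add (hint'.const_mul _)) fun ω => ?_
        have h1 := exp_le_one_add_add_sq_mul_exp_abs (s * (W ω - m))
        have h2 := sq_mul_exp_le (x := W ω - m) ha hs
        simp only
        linarith
    _ = 1 + 8 / a ^ 2 * s ^ 2 * ∫ ω, Real.exp (a * |W ω - m|) ∂P := by
        have h12 : Integrable (fun ω => 1 + s * (W ω - m)) P :=
          (integrable_const 1).add (hcint.const_mul s)
        rw [integral_add h12 (hint'.const_mul _),
          integral_add (integrable_const 1) (hcint.const_mul s), integral_const_mul,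
          integral_const_mul, hc0]
        simp
    _ ≤ 1 + 8 / a ^ 2 * s ^ 2 * (Real.exp K * K) := by
        gcongr
        calc ∫ ω, Real.exp (a * |W ω - m|) ∂P ≤ ∫ ω, Real.exp K * Real.exp (a * |W ω|) ∂P :=
              integral_mono hint' (hint.const_mul _) hbd
          _ = Real.exp K * ∫ ω, Real.exp (a * |W ω|) ∂P := integral_const_mul _ _
          _ ≤ _ := by gcongr
    _ = 8 * K * Real.exp K / a ^ 2 * s ^ 2 + 1 := by ring
    _ ≤ _ := Real.add_one_le_exp _

/-- One-sided Bernstein bound for sums of independent variables whose moment generating functions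
are of sub-Gaussian type near the origin. -/
theorem measureReal_sum_ge_le {N : ℕ} {W : Fin N → Ω → ℝ} (hind : iIndepFun W P)
    (hW : ∀ i, AEMeasurable (W i) P) {C u s : ℝ} (hC : 0 < C) (hu : 0 ≤ u) (hs : s = u / (2 * C))
    (hint : ∀ i, Integrable (fun ω => Real.exp (s * W i ω)) P)
    (hmgf : ∀ i, mgf (W i) P s ≤ Real.exp (C * s ^ 2)) :
    P.real {ω | N * u ≤ ∑ i, W i ω} ≤ Real.exp (-(N * u ^ 2 / (4 * C))) := by
  have hs0 : 0 ≤ s := by rw [hs]; positivity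
  have hI : Integrable (fun ω => Real.exp (s * (∑ i, W i) ω)) P := by
    -- A non-integrable exponential would have integral zero by convention, whereas the moment
    -- generating function of the sum is a product of positive factors.
    by_contra hI
    have h0 : mgf (∑ i, W i) P s = 0 := integral_undef hI
    rw [hind.mgf_sum₀ hW] at h0
    exact (Finset.prod_pos fun i _ => mgf_pos (hint i)).ne' h0
  have h1 := measure_ge_le_exp_mul_mgf (μ := P) (X := ∑ i, W i) (N * u) hs0 hI
  rw [hind.mgf_sum₀ hW] at h1
  simp only [Finset.sum_apply] at h1
  refine h1.trans ?_
  calc Real.exp (-s * (N * u)) * ∏ i, mgf (W i) P s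
      ≤ Real.exp (-s * (N * u)) * ∏ _i : Fin N, Real.exp (C * s ^ 2) := by
        gcongr with i
        · exact fun i _ => mgf_nonneg
        · exact hmgf i
    _ = Real.exp (-(N * u ^ 2 / (4 * C))) := by
        rw [Finset.prod_const, Finset.card_univ, Fintype.card_fin, ← Real.exp_nat_mul,
          ← Real.exp_add, hs]
        congr 1
        field_simp
        ring

end MGF

/-! ### Exponential moments of squares and products of sub-Gaussian variables. -/

theorem integrable_exp_sq_div_four_gaussianReal :
    Integrable (fun g : ℝ => Real.exp (g ^ 2 / 4)) (gaussianReal 0 1) := by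
  rw [gaussianReal_of_var_ne_zero 0 one_ne_zero, integrable_withDensity_iff
    (measurable_gaussianPDF 0 1) (Eventually.of_forall fun x => gaussianPDF_lt_top)]
  have : (fun x : ℝ => Real.exp (x ^ 2 / 4) * (gaussianPDF 0 1 x).toReal)
      = fun x => (√(2 * Real.pi))⁻¹ * Real.exp (-(1 / 4) * x ^ 2) := by
    ext x
    rw [toReal_gaussianPDF, gaussianPDFReal]
    simp only [NNReal.coe_one, mul_one, sub_zero]
    rw [mul_left_comm, ← Real.exp_add]
    congr 2
    ring
  rw [this]
  exact (integrable_exp_neg_mul_sq (by norm_num)).const_mul _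

/-- The expectation of `exp (g² / 4)` for a standard Gaussian `g`. -/
noncomputable def gaussianSqMoment : ℝ := ∫ g, Real.exp (g ^ 2 / 4) ∂(gaussianReal 0 1)

theorem gaussianSqMoment_pos : 0 < gaussianSqMoment :=
  integral_exp_pos integrable_exp_sq_div_four_gaussianReal

section Square

variable {Ω : Type*} [MeasurableSpace Ω] {P : Measure Ω} [IsProbabilityMeasure P]

/-- The square of a sub-Gaussian variable has an exponential moment. -/
theorem exp_sq_moment {U : Ω → ℝ} {c : NNReal} (hc : 0 < c) (hU : HasSubgaussianMGF U c P) :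
    Integrable (fun ω => Real.exp (U ω ^ 2 / (4 * c))) P ∧
      ∫ ω, Real.exp (U ω ^ 2 / (4 * c)) ∂P ≤ gaussianSqMoment := by
  have hUm : AEMeasurable U P := hU.aemeasurable
  have hc' : (0 : ℝ) < c := hc
  have hm : AEMeasurable (fun ω => Real.exp (U ω ^ 2 / (4 * c))) P := by fun_prop
  have key : ∫⁻ ω, ENNReal.ofReal (Real.exp (U ω ^ 2 / (4 * c))) ∂P
      ≤ ENNReal.ofReal gaussianSqMoment := by
    -- Gaussian linearization: exp (U² / (4c)) = E_g exp (g U / √(2c)). After Tonelli, the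
    -- sub-Gaussian bound on U at t = g / √(2c) leaves exp (g² / 4), which is integrable under the
    -- standard Gaussian law.
    have h1 : ∀ ω, ENNReal.ofReal (Real.exp (U ω ^ 2 / (4 * c)))
        = ∫⁻ g, ENNReal.ofReal (Real.exp (g / √(2 * c) * U ω)) ∂(gaussianReal 0 1) := by
      intro ω
      have h := congrFun (mgf_fun_id_gaussianReal (μ := 0) (v := 1)) (U ω / √(2 * c))
      have h2 : ∀ g : ℝ, g / √(2 * c) * U ω = U ω / √(2 * c) * g := fun g => by ring
      simp_rw [h2]
      rw [← ofReal_integral_eq_lintegral_ofReal (integrable_exp_mul_gaussianReal _)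
        (Eventually.of_forall fun g => (Real.exp_pos _).le)]
      rw [mgf] at h
      rw [h]
      congr 2
      rw [div_pow, Real.sq_sqrt (by positivity)]
      simp
      field_simp
      norm_num
    simp_rw [h1]
    rw [lintegral_lintegral_swap]
    · rw [gaussianSqMoment, ofReal_integral_eq_lintegral_ofReal
        integrable_exp_sq_div_four_gaussianReal (Eventually.of_forall fun g => (Real.exp_pos _).le)]
      refine lintegral_mono fun g => ?_
      rw [← ofReal_integral_eq_lintegral_ofReal (hU.integrable_exp_mul _)
        (Eventually.of_forall fun g => (Real.exp_pos _).le)]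
      refine ENNReal.ofReal_le_ofReal ((hU.mgf_le _).trans_eq ?_)
      congr 1
      rw [div_pow, Real.sq_sqrt (by positivity)]
      field_simp
      norm_num
    · have : AEMeasurable (fun p : Ω × ℝ => U p.1) (P.prod (gaussianReal 0 1)) :=
        hUm.comp_quasiMeasurePreserving Measure.quasiMeasurePreserving_fst
      unfold Function.uncurry
      fun_prop
  have hint : Integrable (fun ω => Real.exp (U ω ^ 2 / (4 * c))) P := by
    refine ⟨hm.aestronglyMeasurable, ?_⟩
    rw [hasFiniteIntegral_iff_ofReal (Eventually.of_forall fun ω => (Real.exp_pos _).le)]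
    exact key.trans_lt ENNReal.ofReal_lt_top
  refine ⟨hint, ?_⟩
  rw [← ofReal_integral_eq_lintegral_ofReal hint
    (Eventually.of_forall fun ω => (Real.exp_pos _).le)] at key
  exact (ENNReal.ofReal_le_ofReal_iff gaussianSqMoment_pos.le).1 key

/-- The product of two sub-Gaussian variables has an exponential absolute moment. -/
theorem exp_abs_mul_moment {U V : Ω → ℝ} {c : NNReal} (hc : 0 < c) (hU : HasSubgaussianMGF U c P)
    (hV : HasSubgaussianMGF V c P) :
    Integrable (fun ω => Real.exp (1 / (4 * c) * |U ω * V ω|)) P ∧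
      ∫ ω, Real.exp (1 / (4 * c) * |U ω * V ω|) ∂P ≤ 2 * gaussianSqMoment := by
  obtain ⟨hU1, hU2⟩ := exp_sq_moment hc hU
  obtain ⟨hV1, hV2⟩ := exp_sq_moment hc hV
  have hc' : (0 : ℝ) < c := hc
  have hUm : AEMeasurable U P := hU.aemeasurable
  have hVm : AEMeasurable V P := hV.aemeasurable
  have hbd : ∀ ω, Real.exp (1 / (4 * c) * |U ω * V ω|)
      ≤ Real.exp (U ω ^ 2 / (4 * c)) + Real.exp (V ω ^ 2 / (4 * c)) := by
    intro ω
    -- This pointwise bound requires no independence between U and V, so U = V is allowed.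
    have h1 : |U ω * V ω| ≤ max (U ω ^ 2) (V ω ^ 2) := by
      rw [abs_mul]
      rcases le_total |U ω| |V ω| with h | h
      · refine le_max_of_le_right ?_
        rw [← sq_abs (V ω)]; nlinarith [abs_nonneg (V ω)]
      · refine le_max_of_le_left ?_
        rw [← sq_abs (U ω)]; nlinarith [abs_nonneg (U ω)]
    rcases le_max_iff.1 h1 with h | h
    · have : Real.exp (1 / (4 * c) * |U ω * V ω|) ≤ Real.exp (U ω ^ 2 / (4 * c)) := by
        rw [Real.exp_le_exp, div_mul_eq_mul_div, one_mul]; gcongr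
      linarith [Real.exp_pos (V ω ^ 2 / (4 * c))]
    · have : Real.exp (1 / (4 * c) * |U ω * V ω|) ≤ Real.exp (V ω ^ 2 / (4 * c)) := by
        rw [Real.exp_le_exp, div_mul_eq_mul_div, one_mul]; gcongr
      linarith [Real.exp_pos (U ω ^ 2 / (4 * c))]
  have hint : Integrable (fun ω => Real.exp (1 / (4 * c) * |U ω * V ω|)) P := by
    refine Integrable.mono' (hU1.add hV1) (by fun_prop) (Eventually.of_forall fun ω => ?_)
    rw [Real.norm_eq_abs, abs_of_pos (Real.exp_pos _)]
    exact hbd ω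
  refine ⟨hint, (integral_mono hint (hU1.add hV1) hbd).trans ?_⟩
  simp only [Pi.add_apply]
  rw [integral_add hU1 hV1]
  linarith

end Square

/-- Bernstein's inequality for sums of products of sub-Gaussian variables. -/
theorem exists_bernstein_mul {c : NNReal} (hc : 0 < c) :
    ∃ C > (0 : ℝ), ∃ u₀ > (0 : ℝ), ∀ {Ω : Type*} [MeasurableSpace Ω] {P : Measure Ω}
      [IsProbabilityMeasure P] {N : ℕ} {U V : Fin N → Ω → ℝ},
      iIndepFun (fun i ω => U i ω * V i ω) P → (∀ i, HasSubgaussianMGF (U i) c P) →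
      (∀ i, HasSubgaussianMGF (V i) c P) → ∀ {m : ℝ}, (∀ i, ∫ ω, U i ω * V i ω ∂P = m) →
      ∀ {u : ℝ}, 0 ≤ u → u ≤ u₀ →
        P.real {ω | N * u ≤ |∑ i, (U i ω * V i ω - m)|} ≤ 2 * Real.exp (-(N * u ^ 2 / C)) := by
  have hc' : (0 : ℝ) < c := hc
  set a : ℝ := 1 / (4 * c) with ha
  have ha0 : 0 < a := by positivity
  set K := 2 * gaussianSqMoment with hKdef
  have hK0 : 0 < K := by have := gaussianSqMoment_pos; positivity
  set C := 8 * K * Real.exp K / a ^ 2 with hCdef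
  have hC0 : 0 < C := by positivity
  -- The Chernoff parameter s = u / (2C) minimizes C s² - s u; it stays in the range |s| ≤ a / 2
  -- exactly when u ≤ a C.
  refine ⟨4 * C, by positivity, a * C, by positivity, ?_⟩
  intro Ω _ P _ N U V hind hU hV m hm u hu huu
  have hUm : ∀ i, AEMeasurable (U i) P := fun i => (hU i).aemeasurable
  have hVm : ∀ i, AEMeasurable (V i) P := fun i => (hV i).aemeasurable
  have hWm : ∀ i, AEMeasurable (fun ω => U i ω * V i ω) P := fun i => (hUm i).mul (hVm i)
  have hs0 : 0 ≤ u / (2 * C) := by positivity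
  have hs1 : u / (2 * C) ≤ a / 2 := by
    rw [div_le_div_iff₀ (by positivity) (by positivity)]; linarith
  have h1 := fun i (s : ℝ) (hs : |s| ≤ a / 2) => mgf_centered_le ha0 (hWm i)
    (exp_abs_mul_moment hc (hU i) (hV i)).1 (exp_abs_mul_moment hc (hU i) (hV i)).2 hs
  simp only [hm] at h1
  have hp := measureReal_sum_ge_le (P := P) (W := fun i ω => U i ω * V i ω - m)
    (hind.comp (fun _ y => y - m) (fun _ => by fun_prop)) (fun i => (hWm i).sub_const m) hC0 hu rfl
    (fun i => (h1 i _ (by rwa [abs_of_nonneg hs0])).1)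
    (fun i => (h1 i _ (by rwa [abs_of_nonneg hs0])).2)
  have hn := measureReal_sum_ge_le (P := P) (W := fun i ω => -(U i ω * V i ω - m))
    (hind.comp (fun _ y => -(y - m)) (fun _ => by fun_prop))
    (fun i => ((hWm i).sub_const m).neg) hC0 hu rfl
    (fun i => by
      have := (h1 i (-(u / (2 * C))) (by rwa [abs_neg, abs_of_nonneg hs0])).1
      simpa only [mul_neg, neg_mul] using this)
    (fun i => by
      have := (h1 i (-(u / (2 * C))) (by rwa [abs_neg, abs_of_nonneg hs0])).2
      simpa only [mgf, mul_neg, neg_mul, neg_sq] using this)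
  have hsub : {ω | N * u ≤ |∑ i, (U i ω * V i ω - m)|} ⊆
      {ω | N * u ≤ ∑ i, (U i ω * V i ω - m)} ∪ {ω | N * u ≤ ∑ i, -(U i ω * V i ω - m)} := by
    intro ω hω
    simp only [Set.mem_ofPred_eq, Set.mem_union, Finset.sum_neg_distrib] at hω ⊢
    exact le_abs.1 hω
  calc P.real {ω | N * u ≤ |∑ i, (U i ω * V i ω - m)|}
      ≤ _ := (measureReal_mono hsub).trans (measureReal_union_le _ _)
    _ ≤ _ := by linarith

end GraphLasso

namespace GraphLasso

/-! ### Convergence in distribution along a sequence of probability spaces -/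

/-- If `Z t` has law `ν` eventually and `T t - Z t` tends to zero in probability, then `T t`
converges in distribution to `ν`; the probability spaces may vary. -/
theorem tendstoInDistribution_of_close {Ω : ℕ → Type*} [∀ t, MeasurableSpace (Ω t)]
    {P : ∀ t, Measure (Ω t)} [∀ t, IsProbabilityMeasure (P t)] {ν : Measure ℝ}
    [IsProbabilityMeasure ν] {T Z : ∀ t, Ω t → ℝ} (hT : ∀ t, AEMeasurable (T t) (P t))
    (hZ : ∀ᶠ t in atTop, HasLaw (Z t) ν (P t))
    (hclose : ∀ η > 0, ∀ δ > 0, ∀ᶠ t in atTop, (P t).real {ω | η < |T t ω - Z t ω|} ≤ δ) :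
    TendstoInDistribution T atTop (id : ℝ → ℝ) P ν := by
  refine ⟨hT, aemeasurable_id, ?_⟩
  -- Bounded Lipschitz test functions suffice: the integrands differ by at most L η where the
  -- variables are η-close, and by at most the oscillation C elsewhere.
  refine tendsto_iff_forall_lipschitz_integral_tendsto.2 ?_
  rintro f ⟨C, hC⟩ ⟨L, hL⟩
  have hfc : Continuous f := hL.continuous
  have hC0 : 0 ≤ C := dist_nonneg.trans (hC 0 0)
  simp only [ProbabilityMeasure.coe_mk, Measure.map_id]
  rw [Metric.tendsto_atTop']
  intro e he
  obtain ⟨η, hη, hη1⟩ : ∃ η > 0, (L : ℝ) * η ≤ e / 4 :=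
    ⟨e / (4 * (L + 1)), by positivity, by
      rw [mul_div_assoc', div_le_div_iff₀ (by positivity) (by positivity)]
      nlinarith [L.coe_nonneg]⟩
  obtain ⟨δ, hδ, hδ1⟩ : ∃ δ > 0, C * δ ≤ e / 4 :=
    ⟨e / (4 * (C + 1)), by positivity, by
      rw [mul_div_assoc', div_le_div_iff₀ (by positivity) (by positivity)]
      nlinarith⟩
  obtain ⟨t₀, ht₀⟩ := eventually_atTop.1 (hZ.and (hclose η hη δ hδ))
  refine ⟨t₀, fun t ht => ?_⟩
  obtain ⟨hZt, hPt⟩ := ht₀ t ht.le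
  have hZm := hZt.aemeasurable
  rw [integral_map (hT t) hfc.aestronglyMeasurable, ← hZt.map_eq,
    integral_map hZm hfc.aestronglyMeasurable]
  have hbdd : ∀ x, ‖f x‖ ≤ C + ‖f 0‖ := fun x => by
    have h1 := hC x 0
    rw [Real.dist_eq] at h1
    simp only [Real.norm_eq_abs]
    have := abs_sub_abs_le_abs_sub (f x) (f 0)
    linarith
  have hI1 : Integrable (fun ω => f (T t ω)) (P t) :=
    Integrable.of_bound (hfc.comp_aestronglyMeasurable (hT t).aestronglyMeasurable) _
      (Eventually.of_forall fun ω => hbdd _)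
  have hI2 : Integrable (fun ω => f (Z t ω)) (P t) :=
    Integrable.of_bound (hfc.comp_aestronglyMeasurable hZm.aestronglyMeasurable) _
      (Eventually.of_forall fun ω => hbdd _)
  set S := {ω | η < |T t ω - Z t ω|} with hS
  have hSm : NullMeasurableSet S (P t) :=
    nullMeasurableSet_lt aemeasurable_const ((hT t).sub hZm).abs
  have hind : Integrable (S.indicator fun _ => C) (P t) :=
    (integrable_const C).indicator₀ hSm
  rw [Real.dist_eq, ← integral_sub hI1 hI2]
  calc |∫ ω, (f (T t ω) - f (Z t ω)) ∂P t|
      ≤ ∫ ω, |f (T t ω) - f (Z t ω)| ∂P t := abs_integral_le_integral_abs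
    _ ≤ ∫ ω, (L * η + S.indicator (fun _ => C) ω) ∂P t := by
        refine integral_mono (hI1.sub hI2).abs ((integrable_const _).add hind) fun ω => ?_
        by_cases hω : ω ∈ S
        · simp only [Set.indicator_of_mem hω]
          have := hC (T t ω) (Z t ω)
          rw [Real.dist_eq] at this
          have : (0 : ℝ) ≤ L * η := by positivity
          linarith
        · simp only [Set.indicator_of_notMem hω, add_zero]
          have h1 := hL.dist_le_mul (T t ω) (Z t ω)
          rw [Real.dist_eq, Real.dist_eq] at h1
          have h2 : |T t ω - Z t ω| ≤ η := not_lt.1 hω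
          exact h1.trans (by gcongr)
    _ = L * η + C * (P t).real S := by
        rw [integral_add (integrable_const _) hind, integral_indicator₀ hSm]
        simp [mul_comm]
    _ < e := by
        have : C * (P t).real S ≤ C * δ := by gcongr
        linarith

/-! ### Random linear combinations of Gaussian noise -/

section Gaussian

variable {Ω : Type*} [MeasurableSpace Ω] {P : Measure Ω} {N : ℕ} {σ : ℝ}
  {ε : Ω → Fin N → ℝ}

theorem IsGaussianNoise.aemeasurable_apply (h : IsGaussianNoise σ ε P) (i : Fin N) :
    AEMeasurable (fun ω => ε ω i) P := (h.law i).aemeasurable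

theorem IsGaussianNoise.aemeasurable (h : IsGaussianNoise σ ε P) : AEMeasurable ε P :=
  aemeasurable_pi_iff.2 h.aemeasurable_apply

theorem IsGaussianNoise.hasLaw_sum [IsProbabilityMeasure P] (h : IsGaussianNoise σ ε P) (hσ : 0 < σ) {w : Fin N → ℝ}
    (hw : ∑ i, w i ^ 2 = 1) : HasLaw (fun ω => ∑ i, w i * (ε ω i / σ)) (gaussianReal 0 1) P := by
  have hm : ∀ i, AEMeasurable (fun ω => w i * (ε ω i / σ)) P :=
    fun i => ((h.aemeasurable_apply i).div_const σ).const_mul (w i)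
  refine ⟨by fun_prop, Measure.ext_of_charFun (funext fun t => ?_)⟩
  have hind : iIndepFun (fun i ω => w i * (ε ω i / σ)) P :=
    h.indep.comp (fun i y => w i * (y / σ)) (fun i => by fun_prop)
  rw [hind.charFun_map_fun_sum_eq_prod hm, Finset.prod_apply]
  have hl : ∀ i, HasLaw (fun ω => w i * (ε ω i / σ))
      (gaussianReal 0 (Real.toNNReal (w i ^ 2))) P := fun i => by
    have := (gaussianReal_const_mul (gaussianReal_div_const (h.law i) σ) (w i))
    convert this using 2
    · simp
    · ext
      simp [Real.coe_toNNReal _ (sq_nonneg _)]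
      field_simp
  have hc : ∀ i, charFun (P.map fun ω => w i * (ε ω i / σ)) t
      = Complex.exp (((-(t ^ 2 / 2) * w i ^ 2 : ℝ)) : ℂ) := fun i => by
    rw [(hl i).map_eq, charFun_gaussianReal]
    congr 1
    simp [Real.coe_toNNReal _ (sq_nonneg _)]
    ring
  simp_rw [hc, ← Complex.exp_sum, ← Complex.ofReal_sum, ← Finset.mul_sum, hw, charFun_gaussianReal]
  congr 1
  simp

/-- A linear combination of independent Gaussians, whose unit weight vector is a function of an
independent variable, is standard Gaussian. -/
theorem IsGaussianNoise.hasLaw_sum_random [IsProbabilityMeasure P] {α : Type*} [MeasurableSpace α]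
    (h : IsGaussianNoise σ ε P) (hσ : 0 < σ) {X : Ω → α} (hX : Measurable X)
    (hind : IndepFun X ε P) {w : α → Fin N → ℝ} (hwm : ∀ i, Measurable fun x => w x i)
    (hw : ∀ x, ∑ i, w x i ^ 2 = 1) :
    HasLaw (fun ω => ∑ i, w (X ω) i * (ε ω i / σ)) (gaussianReal 0 1) P := by
  have hε := h.aemeasurable
  have hεi := h.aemeasurable_apply
  have hf : Measurable fun p : α × (Fin N → ℝ) => ∑ i, w p.1 i * (p.2 i / σ) := by
    refine Finset.measurable_sum _ fun i _ => ((hwm i).comp measurable_fst).mul ?_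
    fun_prop
  have hXε : AEMeasurable (fun ω => (X ω, ε ω)) P := hX.aemeasurable.prodMk hε
  refine ⟨hf.comp_aemeasurable hXε, ?_⟩
  have h1 : P.map (fun ω => ∑ i, w (X ω) i * (ε ω i / σ))
      = (P.map fun ω => (X ω, ε ω)).map fun p => ∑ i, w p.1 i * (p.2 i / σ) := by
    rw [AEMeasurable.map_map_of_aemeasurable hf.aemeasurable hXε]
    rfl
  rw [h1, (indepFun_iff_map_prod_eq_prod_map_map hX.aemeasurable hε).1 hind]
  have := Measure.isProbabilityMeasure_map (μ := P) hε
  have := Measure.isProbabilityMeasure_map (μ := P) hX.aemeasurable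
  ext B hB
  rw [Measure.map_apply hf hB, Measure.prod_apply (hf hB)]
  -- Under the product law each section over a fixed x has the same N(0, 1) probability, so
  -- integrating over x changes nothing.
  have h2 : ∀ x, (P.map ε) (Prod.mk x ⁻¹' ((fun p : α × (Fin N → ℝ) =>
      ∑ i, w p.1 i * (p.2 i / σ)) ⁻¹' B)) = gaussianReal 0 1 B := fun x => by
    have hg : Measurable fun e : Fin N → ℝ => ∑ i, w x i * (e i / σ) := by fun_prop
    rw [← (h.hasLaw_sum hσ (hw x)).map_eq, ← Set.preimage_comp]
    have := Measure.map_apply (μ := P.map ε) hg hB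
    rw [AEMeasurable.map_map_of_aemeasurable hg.aemeasurable hε] at this
    exact this.symm
  simp_rw [h2]
  simp

end Gaussian

end GraphLasso

namespace GraphLasso

/-! ### Operator bounds for graph differences -/

section Graph

variable {n : ℕ} (G : SimpleGraph (Fin n))

theorem maxDeg_nonneg : 0 ≤ maxDeg G := Nat.cast_nonneg _

theorem incidence_mulVec_apply (v : Fin n → ℝ) (e : Edge G) :
    (incidence G *ᵥ v) e = v e.1.2 - v e.1.1 := by
  have hne : e.1.1 ≠ e.1.2 := e.2.1.ne
  have h : ∀ x, incidence G e x * v x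
      = (if x = e.1.1 then -v x else 0) + (if x = e.1.2 then v x else 0) := by
    intro x
    unfold incidence
    by_cases h1 : x = e.1.1
    · have : x ≠ e.1.2 := fun h => hne (h1 ▸ h)
      simp [h1, hne]
    · by_cases h2 : x = e.1.2 <;> simp [h1, h2, hne.symm]
  simp only [mulVec, dotProduct, h, Finset.sum_add_distrib, Finset.sum_ite_eq', Finset.mem_univ,
    if_true]
  ring

theorem sum_adj_le_maxDeg (i : Fin n) [DecidableRel G.Adj] :
    ∑ j, (if G.Adj i j then (1 : ℝ) else 0) ≤ maxDeg G := by
  classical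
  have h : ∑ j, (if G.Adj i j then (1 : ℝ) else 0) = G.degree i := by
    rw [Finset.sum_boole, ← SimpleGraph.card_neighborFinset_eq_degree,
      SimpleGraph.neighborFinset_eq_filter]
  rw [h, maxDeg]
  refine Nat.cast_le.2 ?_
  convert G.degree_le_maxDegree i

/-- On each edge (a - b)² ≤ 2 (a² + b²), and a vertex lies on at most d edges. This bound on ‖F‖² is
the source of every factor 2d. -/
theorem sum_sq_incidence_mulVec_le (v : Fin n → ℝ) :
    ∑ e, (incidence G *ᵥ v) e ^ 2 ≤ 2 * maxDeg G * ∑ i, v i ^ 2 := by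
  classical
  have h1 : ∑ e : Edge G, (incidence G *ᵥ v) e ^ 2
      ≤ ∑ e : Edge G, 2 * (v e.1.1 ^ 2 + v e.1.2 ^ 2) := by
    refine Finset.sum_le_sum fun e _ => ?_
    rw [incidence_mulVec_apply]
    nlinarith [sq_nonneg (v e.1.2 + v e.1.1)]
  have h2 : ∑ e : Edge G, 2 * (v e.1.1 ^ 2 + v e.1.2 ^ 2)
      = ∑ i, ∑ j, if i < j ∧ G.Adj i j then 2 * (v i ^ 2 + v j ^ 2) else 0 := by
    rw [← Fintype.sum_prod_type'
      (f := fun i j => if i < j ∧ G.Adj i j then 2 * (v i ^ 2 + v j ^ 2) else 0),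
      ← Finset.sum_filter]
    symm
    convert Finset.sum_subtype (p := fun p : Fin n × Fin n => p.1 < p.2 ∧ G.Adj p.1 p.2)
      (Finset.univ.filter fun p : Fin n × Fin n => p.1 < p.2 ∧ G.Adj p.1 p.2)
      (fun p => by simp) (fun p => 2 * (v p.1 ^ 2 + v p.2 ^ 2))
  have h3 : ∑ i, ∑ j, (if i < j ∧ G.Adj i j then 2 * (v i ^ 2 + v j ^ 2) else 0)
      = ∑ i, ∑ j, (if i < j ∧ G.Adj i j then 2 * v i ^ 2 else 0)
        + ∑ i, ∑ j, (if j < i ∧ G.Adj i j then 2 * v i ^ 2 else 0) := by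
    rw [Finset.sum_comm (f := fun i j => if j < i ∧ G.Adj i j then 2 * v i ^ 2 else 0),
      ← Finset.sum_add_distrib]
    refine Finset.sum_congr rfl fun i _ => ?_
    rw [← Finset.sum_add_distrib]
    refine Finset.sum_congr rfl fun j _ => ?_
    rw [G.adj_comm j i]
    split_ifs <;> ring
  rw [h2, h3, ← Finset.sum_add_distrib] at h1
  refine h1.trans ?_
  rw [Finset.mul_sum]
  refine Finset.sum_le_sum fun i _ => ?_
  rw [← Finset.sum_add_distrib]
  calc ∑ j, ((if i < j ∧ G.Adj i j then 2 * v i ^ 2 else 0)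
        + (if j < i ∧ G.Adj i j then 2 * v i ^ 2 else 0))
      ≤ ∑ j, 2 * v i ^ 2 * (if G.Adj i j then (1 : ℝ) else 0) := by
        refine Finset.sum_le_sum fun j _ => ?_
        have : 0 ≤ v i ^ 2 := sq_nonneg _
        by_cases ha : G.Adj i j
        · rcases lt_trichotomy i j with h | h | h
          · simp [ha, h, h.not_gt]
          · exact absurd (h ▸ ha) (G.irrefl)
          · simp [ha, h, h.not_gt]
        · simp [ha]
    _ = 2 * v i ^ 2 * ∑ j, (if G.Adj i j then (1 : ℝ) else 0) := by rw [Finset.mul_sum]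
    _ ≤ 2 * v i ^ 2 * maxDeg G := by
        gcongr
        exact sum_adj_le_maxDeg G i
    _ = _ := by ring

/-- A matrix and its transpose have the same operator norm: ‖Aᵀw‖² = ⟨w, A Aᵀ w⟩, and Cauchy-Schwarz
applies. -/
theorem sum_sq_transpose_mulVec_le {ι κ : Type*} [Fintype ι] [Fintype κ] {A : Matrix ι κ ℝ} {c : ℝ}
    (hc : 0 ≤ c) (hA : ∀ v, ∑ i, (A *ᵥ v) i ^ 2 ≤ c * ∑ j, v j ^ 2) (w : ι → ℝ) :
    ∑ j, (Aᵀ *ᵥ w) j ^ 2 ≤ c * ∑ i, w i ^ 2 := by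
  set q := ∑ j, (Aᵀ *ᵥ w) j ^ 2 with hq
  have hq0 : 0 ≤ q := Finset.sum_nonneg fun _ _ => sq_nonneg _
  have hw0 : 0 ≤ ∑ i, w i ^ 2 := Finset.sum_nonneg fun _ _ => sq_nonneg _
  have h1 : q = ∑ i, w i * (A *ᵥ (Aᵀ *ᵥ w)) i := by
    have : w ⬝ᵥ (A *ᵥ (Aᵀ *ᵥ w)) = (Aᵀ *ᵥ w) ⬝ᵥ (Aᵀ *ᵥ w) := by
      rw [dotProduct_mulVec, ← mulVec_transpose]
    simp only [dotProduct] at this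
    rw [this, hq]
    exact Finset.sum_congr rfl fun i _ => sq _
  have h2 : q ^ 2 ≤ (∑ i, w i ^ 2) * (c * q) := by
    calc q ^ 2 ≤ (∑ i, w i ^ 2) * ∑ i, (A *ᵥ (Aᵀ *ᵥ w)) i ^ 2 := by
          conv_lhs => rw [h1]
          exact Finset.sum_mul_sq_le_sq_mul_sq _ _ _
      _ ≤ _ := by gcongr; exact hA _
  rcases hq0.eq_or_lt with h | h
  · rw [← h]; positivity
  · nlinarith

theorem sum_sq_laplacian_mulVec_le (v : Fin n → ℝ) :
    ∑ i, (laplacian G *ᵥ v) i ^ 2 ≤ (2 * maxDeg G) ^ 2 * ∑ i, v i ^ 2 := by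
  have hd : 0 ≤ 2 * maxDeg G := by have := maxDeg_nonneg G; positivity
  rw [laplacian, ← mulVec_mulVec]
  calc _ ≤ 2 * maxDeg G * ∑ e, (incidence G *ᵥ v) e ^ 2 :=
        sum_sq_transpose_mulVec_le hd (sum_sq_incidence_mulVec_le G) _
    _ ≤ 2 * maxDeg G * (2 * maxDeg G * ∑ i, v i ^ 2) := by
        gcongr; exact sum_sq_incidence_mulVec_le G v
    _ = _ := by ring

theorem sum_sq_laplacian_pow_mulVec_le (m : ℕ) (v : Fin n → ℝ) :
    ∑ i, ((laplacian G ^ m) *ᵥ v) i ^ 2 ≤ (2 * maxDeg G) ^ (2 * m) * ∑ i, v i ^ 2 := by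
  induction m generalizing v with
  | zero => simp
  | succ m ih =>
    rw [pow_succ, ← mulVec_mulVec]
    calc _ ≤ (2 * maxDeg G) ^ (2 * m) * ∑ i, (laplacian G *ᵥ v) i ^ 2 := ih _
      _ ≤ (2 * maxDeg G) ^ (2 * m) * ((2 * maxDeg G) ^ 2 * ∑ i, v i ^ 2) := by
          have := maxDeg_nonneg G
          gcongr
          exact sum_sq_laplacian_mulVec_le G v
      _ = _ := by ring

theorem sum_sq_graphDiff_mulVec_le (k : ℕ) (v : Fin n → ℝ) :
    ∑ r, (graphDiff G k *ᵥ v) r ^ 2 ≤ (2 * maxDeg G) ^ (k + 1) * ∑ i, v i ^ 2 := by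
  have hd := maxDeg_nonneg G
  rcases Nat.even_or_odd k with hk | hk
  · have hk' : decide (Odd k) = false := by simpa using hk
    rw [graphDiff, hk']
    change ∑ e : Edge G, ((incidence G * laplacian G ^ (k / 2)) *ᵥ v) e ^ 2 ≤ _
    rw [← mulVec_mulVec]
    calc _ ≤ 2 * maxDeg G * ∑ i, ((laplacian G ^ (k / 2)) *ᵥ v) i ^ 2 :=
          sum_sq_incidence_mulVec_le G _
      _ ≤ 2 * maxDeg G * ((2 * maxDeg G) ^ (2 * (k / 2)) * ∑ i, v i ^ 2) := by
          gcongr; exact sum_sq_laplacian_pow_mulVec_le G _ v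
      _ = _ := by rw [Nat.two_mul_div_two_of_even hk]; ring
  · have hk' : decide (Odd k) = true := by simpa using hk
    rw [graphDiff, hk']
    change ∑ i : Fin n, ((laplacian G ^ ((k + 1) / 2)) *ᵥ v) i ^ 2 ≤ _
    have := sum_sq_laplacian_pow_mulVec_le G ((k + 1) / 2) v
    rwa [Nat.two_mul_div_two_of_even hk.add_one] at this

end Graph

/-! ### `ℓ₁` and `ℓ₀` -/

section Norms

variable {ι : Type} [Fintype ι]

theorem l1_nonneg (v : ι → ℝ) : 0 ≤ l1 v := Finset.sum_nonneg fun _ _ => abs_nonneg _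

theorem l1_le_sqrt_card_mul (v : ι → ℝ) : l1 v ≤ √(Fintype.card ι) * √(∑ i, v i ^ 2) := by
  have h := sq_sum_le_card_mul_sum_sq (s := Finset.univ) (f := fun i => |v i|)
  simp only [sq_abs, Finset.card_univ] at h
  rw [← Real.sqrt_mul (by positivity)]
  exact Real.le_sqrt_of_sq_le h

/-- Moving from `u` to `u + g`, the `ℓ₁`-norm decreases by at most the mass of `g` on the support of
`u` and increases by the mass off the support. -/
theorem l1_sub_l1_add_le (u g : ι → ℝ) :
    l1 u - l1 (u + g) ≤ 2 * (√(l0 u) * √(∑ i, g i ^ 2)) - l1 g := by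
  classical
  set S := Finset.univ.filter fun i => u i ≠ 0 with hS
  have hcard : (l0 u : ℝ) = S.card := by
    rw [l0, ← Set.ncard_coe_finset]
    congr 2
    ext i
    simp [hS]
  have h1 : ∑ i ∈ S, |g i| ≤ √(l0 u) * √(∑ i, g i ^ 2) := by
    have h := sq_sum_le_card_mul_sum_sq (s := S) (f := fun i => |g i|)
    simp only [sq_abs] at h
    rw [← Real.sqrt_mul (by positivity), hcard]
    refine Real.le_sqrt_of_sq_le (h.trans ?_)
    gcongr
    exact Finset.subset_univ _
  have h2 : l1 u - l1 (u + g) ≤ 2 * ∑ i ∈ S, |g i| - l1 g := by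
    rw [hS, Finset.sum_filter, Finset.mul_sum, l1, l1, l1, ← Finset.sum_sub_distrib,
      ← Finset.sum_sub_distrib]
    refine Finset.sum_le_sum fun i _ => ?_
    by_cases hi : u i = 0
    · simp [hi]
    · simp only [Pi.add_apply, ne_eq, hi, not_false_eq_true, if_true]
      have := abs_sub (u i + g i) (g i)
      rw [add_sub_cancel_right] at this
      linarith
  linarith

/-- Average of the bound 2 √(l0 u) ‖g‖₂ - ‖g‖₁ and the triangle bound ‖g‖₁; the terms ‖g‖₁ cancel.
-/
theorem l1_sub_l1_add_le_sqrt (u g : ι → ℝ) :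
    l1 u - l1 (u + g) ≤ √(l0 u) * √(∑ i, g i ^ 2) := by
  have h1 := l1_sub_l1_add_le u g
  have h2 : l1 u - l1 (u + g) ≤ l1 g := by
    rw [l1, l1, l1, ← Finset.sum_sub_distrib]
    refine Finset.sum_le_sum fun i _ => ?_
    have := abs_sub (u i + g i) (g i)
    rw [add_sub_cancel_right] at this
    simp only [Pi.add_apply]
    linarith
  linarith

end Norms

/-! ### Deterministic error bounds for the Graph-Piecewise-Polynomial-Lasso -/

section Lasso

variable {N n : ℕ}

/-- The graph penalty is dominated by a multiple of the Euclidean norm. -/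
theorem graph_penalty_le (G : SimpleGraph (Fin n)) {k : ℕ} {ν s₁ s₂ lam lamg : ℝ} (hν : 0 ≤ ν)
    (hs₁ : 0 < s₁) (hνs : ν ≤ s₂ / s₁) (hlam : 0 ≤ lam)
    (hlamg : lamg = lam * √(ν / (2 * maxDeg G) ^ (k + 1))) {β : Fin n → ℝ}
    (hβ : β ∈ paramSpace G k s₁ s₂) (h : Fin n → ℝ) :
    lamg * (l1 (graphDiff G k *ᵥ β) - l1 (graphDiff G k *ᵥ (β + h)))
      ≤ lam * (√s₂ * √(∑ a, h a ^ 2)) := by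
  set D := (2 * maxDeg G) ^ (k + 1) with hD
  have hD0 : 0 ≤ D := pow_nonneg (by have := maxDeg_nonneg G; positivity) _
  have hlamg0 : 0 ≤ lamg := by rw [hlamg]; positivity
  set q := ∑ a, h a ^ 2 with hq
  have hq0 : 0 ≤ q := Finset.sum_nonneg fun _ _ => sq_nonneg _
  have h1 : l1 (graphDiff G k *ᵥ β) - l1 (graphDiff G k *ᵥ (β + h)) ≤ √s₁ * √(D * q) := by
    rw [mulVec_add]
    refine (l1_sub_l1_add_le_sqrt _ _).trans ?_
    gcongr
    · exact hβ.1
    · exact sum_sq_graphDiff_mulVec_le G k h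
  calc lamg * (l1 (graphDiff G k *ᵥ β) - l1 (graphDiff G k *ᵥ (β + h)))
      ≤ lamg * (√s₁ * √(D * q)) := by gcongr
    _ = lam * √((ν / D) * (s₁ * (D * q))) := by
        rw [hlamg, ← Real.sqrt_mul hs₁.le, mul_assoc, ← Real.sqrt_mul (by positivity)]
    _ ≤ lam * √(s₂ * q) := by
        rw [le_div_iff₀ hs₁] at hνs
        refine mul_le_mul_of_nonneg_left (Real.sqrt_le_sqrt ?_) hlam
        -- For d = 0 the quotient ν / 0 is 0, in agreement with the convention λ_g = 0.
        rcases hD0.eq_or_lt with h0 | h0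
        · rw [← h0]
          have : 0 ≤ s₂ := le_trans (by positivity) hνs
          simp only [div_zero, zero_mul]
          positivity
        · calc ν / D * (s₁ * (D * q)) = ν * s₁ * q := by field_simp
            _ ≤ s₂ * q := by gcongr
    _ = _ := by
        rw [Real.sqrt_mul' _ hq0]

theorem dotProduct_sampleCov_mulVec (X : Matrix (Fin N) (Fin n) ℝ) (h : Fin n → ℝ) :
    h ⬝ᵥ (sampleCov X *ᵥ h) = 1 / N * ∑ i, (X *ᵥ h) i ^ 2 := by
  rw [sampleCov, smul_mulVec, dotProduct_smul, ← mulVec_mulVec, dotProduct_mulVec, vecMul_transpose,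
    smul_eq_mul]
  congr 1
  exact Finset.sum_congr rfl fun i _ => (sq _).symm

theorem abs_dotProduct_mulVec_le {M : Matrix (Fin n) (Fin n) ℝ} {D : ℝ} (hM : ∀ a b, |M a b| ≤ D)
    (h : Fin n → ℝ) : |h ⬝ᵥ (M *ᵥ h)| ≤ D * l1 h ^ 2 := by
  calc |h ⬝ᵥ (M *ᵥ h)| ≤ ∑ a, |h a * (M *ᵥ h) a| := Finset.abs_sum_le_sum_abs _ _
    _ ≤ ∑ a, |h a| * (D * l1 h) := by
        refine Finset.sum_le_sum fun a _ => ?_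
        rw [abs_mul]
        gcongr
        calc |∑ b, M a b * h b| ≤ ∑ b, |M a b * h b| := Finset.abs_sum_le_sum_abs _ _
          _ ≤ ∑ b, D * |h b| := by
              refine Finset.sum_le_sum fun b _ => ?_
              rw [abs_mul]
              gcongr
              exact hM a b
          _ = D * l1 h := by rw [← Finset.mul_sum, l1]
    _ = _ := by rw [← Finset.sum_mul, ← l1]; ring

/-- Restricted eigenvalue bound from an entrywise bound. -/
theorem le_quadratic_sampleCov {X : Matrix (Fin N) (Fin n) ℝ} {S : Matrix (Fin n) (Fin n) ℝ}
    {c D : ℝ} (hS : ∀ v : Fin n → ℝ, c * ∑ a, v a ^ 2 ≤ v ⬝ᵥ (S *ᵥ v))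
    (hD : ∀ a b, |sampleCov X a b - S a b| ≤ D) (h : Fin n → ℝ) :
    c * ∑ a, h a ^ 2 - D * l1 h ^ 2 ≤ h ⬝ᵥ (sampleCov X *ᵥ h) := by
  have h1 := (abs_le.1 (abs_dotProduct_mulVec_le (M := sampleCov X - S) hD h)).1
  rw [sub_mulVec, dotProduct_sub] at h1
  have := hS h
  linarith

theorem sum_mul_mulVec_le {X : Matrix (Fin N) (Fin n) ℝ} {ε : Fin N → ℝ} {τ : ℝ}
    (hτ : ∀ a, |1 / (N : ℝ) * ∑ i, X i a * ε i| ≤ τ) (h : Fin n → ℝ) :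
    1 / (N : ℝ) * ∑ i, ε i * (X *ᵥ h) i ≤ τ * l1 h := by
  have h1 : 1 / (N : ℝ) * ∑ i, ε i * (X *ᵥ h) i
      = ∑ a, (1 / (N : ℝ) * ∑ i, X i a * ε i) * h a := by
    simp only [mulVec, dotProduct, Finset.mul_sum, Finset.sum_mul]
    rw [Finset.sum_comm]
    exact Finset.sum_congr rfl fun a _ => Finset.sum_congr rfl fun i _ => by ring
  rw [h1, l1, Finset.mul_sum]
  refine Finset.sum_le_sum fun a _ => ?_
  calc _ ≤ |(1 / (N : ℝ) * ∑ i, X i a * ε i) * h a| := le_abs_self _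
    _ ≤ _ := by rw [abs_mul]; gcongr; exact hτ a

theorem response_sub_mulVec (X : Matrix (Fin N) (Fin n) ℝ) (β b : Fin n → ℝ) (ε : Fin N → ℝ) :
    response X β ε - X *ᵥ b = ε - X *ᵥ (b - β) := by
  rw [response, mulVec_sub]; abel

/-- Optimality of b is tested against β; expanding the squares around ε cancels the pure noise term.
-/
theorem lasso_basic_inequality {G : SimpleGraph (Fin n)} {k : ℕ} {lamg lam : ℝ}
    {X : Matrix (Fin N) (Fin n) ℝ} {β b : Fin n → ℝ} {ε : Fin N → ℝ}
    (hb : IsGraphLasso G k lamg lam X (response X β ε) b) :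
    1 / (2 * (N : ℝ)) * ∑ i, (X *ᵥ (b - β)) i ^ 2
      ≤ 1 / (N : ℝ) * ∑ i, ε i * (X *ᵥ (b - β)) i
        + lamg * (l1 (graphDiff G k *ᵥ β) - l1 (graphDiff G k *ᵥ b)) + lam * (l1 β - l1 b) := by
  have h := hb β
  have e1 : ∀ i, response X β ε i - (X *ᵥ b) i = ε i - (X *ᵥ (b - β)) i := fun i =>
    congrFun (response_sub_mulVec X β b ε) i
  have e2 : ∀ i, response X β ε i - (X *ᵥ β) i = ε i := fun i => by simp [response]
  simp only [objective, e1, e2, sub_sq, Finset.sum_add_distrib, Finset.sum_sub_distrib] at h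
  have e3 : ∑ i, 2 * ε i * (X *ᵥ (b - β)) i = 2 * ∑ i, ε i * (X *ᵥ (b - β)) i := by
    rw [Finset.mul_sum]; exact Finset.sum_congr rfl fun i _ => by ring
  have e4 : 1 / (N : ℝ) = 2 * (1 / (2 * (N : ℝ))) := by
    rw [one_div, one_div, mul_inv]; ring
  rw [e3] at h
  rw [e4]
  linarith

/-- Error bounds on the event where the sample covariance and the noise are well-behaved. Either the
penalty dominates the noise, or the dimension itself is dominated by `s`. -/
theorem lasso_error_bound {G : SimpleGraph (Fin n)} {k : ℕ} {ν s₁ s₂ s lamg lam c D τ : ℝ}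
    (hν : 0 ≤ ν) (hs₁ : 0 < s₁) (hνs : ν ≤ s₂ / s₁) (hs : s₂ ≤ s) (hlam : 0 < lam)
    (hlamg : lamg = lam * √(ν / (2 * maxDeg G) ^ (k + 1)))
    {X : Matrix (Fin N) (Fin n) ℝ} {S : Matrix (Fin n) (Fin n) ℝ} {β b : Fin n → ℝ}
    {ε : Fin N → ℝ} (hβ : β ∈ paramSpace G k s₁ s₂)
    (hb : IsGraphLasso G k lamg lam X (response X β ε) b) (hc : 0 < c) (hs₂ : 0 < s₂)
    (hS : ∀ v : Fin n → ℝ, c * ∑ a, v a ^ 2 ≤ v ⬝ᵥ (S *ᵥ v))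
    (hD : ∀ a b, |sampleCov X a b - S a b| ≤ D) (hDs : 36 * D * s ≤ c / 2) (hD0 : 0 ≤ D)
    (hτ : ∀ a, |1 / (N : ℝ) * ∑ i, X i a * ε i| ≤ τ) (hτ0 : 0 ≤ τ) (hcase : 2 * τ ≤ lam ∨ n ≤ s) :
    l1 (b - β) ≤ 24 / c * (6 * τ + 3 * lam) * s ∧
      1 / (N : ℝ) * ∑ i, (X *ᵥ (b - β)) i ^ 2 ≤ 8 / c * (6 * τ + 3 * lam) ^ 2 * s := by
  set h := b - β with hh
  have hs0 : 0 < s := hs₂.trans_le hs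
  set q := √(∑ a, h a ^ 2) with hq
  have hq0 : 0 ≤ q := Real.sqrt_nonneg _
  have hqq : ∑ a, h a ^ 2 = q ^ 2 := (Real.sq_sqrt (Finset.sum_nonneg fun _ _ => sq_nonneg _)).symm
  set Q := 1 / (N : ℝ) * ∑ i, (X *ᵥ h) i ^ 2 with hQ
  have hQ0 : 0 ≤ Q := mul_nonneg (by positivity) (Finset.sum_nonneg fun _ _ => sq_nonneg _)
  have hbh : β + h = b := by rw [hh]; abel
  have hbasic := lasso_basic_inequality hb
  have hnoise := sum_mul_mulVec_le hτ h
  have hgraph := graph_penalty_le G hν hs₁ hνs hlam.le hlamg hβ h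
  have hpen := l1_sub_l1_add_le β h
  rw [hbh] at hgraph hpen
  rw [← hh] at hbasic
  have e4 : 1 / (2 * (N : ℝ)) * ∑ i, (X *ᵥ h) i ^ 2 = Q / 2 := by
    rw [hQ, one_div, one_div, mul_inv]; ring
  rw [e4] at hbasic
  have hss : √s₂ ≤ √s := Real.sqrt_le_sqrt hs
  have hl0 : √(l0 β : ℝ) ≤ √s := Real.sqrt_le_sqrt (hβ.2.trans hs)
  have hr0 : 0 ≤ √s := Real.sqrt_nonneg _
  have hrr : √s * √s = s := Real.mul_self_sqrt hs0.le
  set r := √s with hr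
  have hl1 := l1_nonneg h
  have hmain : Q / 2 ≤ τ * l1 h + lam * (r * q) + lam * (2 * (r * q) - l1 h) := by
    have h1 : √s₂ * q ≤ r * q := by gcongr
    have h2 : √(l0 β : ℝ) * q ≤ r * q := by gcongr
    have h3 : lam * (√s₂ * q) ≤ lam * (r * q) := by gcongr
    have h4 : lam * (l1 β - l1 b) ≤ lam * (2 * (r * q) - l1 h) := by
      refine mul_le_mul_of_nonneg_left ?_ hlam.le
      linarith
    linarith
  -- If 2τ ≤ λ, half of λ‖h‖₁ survives in `hmain`, and Q ≥ 0 gives λ‖h‖₁ / 2 ≤ 3λ r q. If n ≤ s, the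
  -- cone condition is just Cauchy-Schwarz in dimension n.
  have hcone : l1 h ≤ 6 * (r * q) := by
    rcases hcase with hc1 | hc1
    · have h1 : 2 * τ * l1 h ≤ lam * l1 h := by gcongr
      have h2 : 0 ≤ lam * (6 * (r * q) - l1 h) := by linarith
      have := nonneg_of_mul_nonneg_right h2 hlam
      linarith
    · have h1 := l1_le_sqrt_card_mul h
      rw [Fintype.card_fin] at h1
      have h2 : √(n : ℝ) * q ≤ r * q :=
        mul_le_mul_of_nonneg_right (Real.sqrt_le_sqrt hc1) hq0
      have : 0 ≤ r * q := by positivity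
      linarith
  set A := 6 * τ + 3 * lam with hA
  have hA0 : 0 ≤ A := by positivity
  have hQ1 : Q ≤ 2 * (A * (r * q)) := by
    have h1 : τ * l1 h ≤ τ * (6 * (r * q)) := by gcongr
    have h2 : 0 ≤ lam * l1 h := by positivity
    rw [hA]
    linarith
  -- On the cone the entrywise perturbation costs at most D (6 r q)² = 36 D s q², which `hDs` keeps
  -- below half of the eigenvalue bound.
  have hQ2 : c / 2 * q ^ 2 ≤ Q := by
    have h1 := le_quadratic_sampleCov hS hD h
    rw [dotProduct_sampleCov_mulVec, hqq] at h1
    have h2 : D * l1 h ^ 2 ≤ D * (6 * (r * q)) ^ 2 := by gcongr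
    have h3 : D * (6 * (r * q)) ^ 2 = 36 * D * s * q ^ 2 := by rw [← hrr]; ring
    have h4 : 36 * D * s * q ^ 2 ≤ c / 2 * q ^ 2 := by gcongr
    linarith
  have hqb : q ≤ 4 / c * A * r := by
    rcases hq0.eq_or_lt with h0 | h0
    · rw [← h0]; positivity
    · have h1 : q * (c / 2 * q) ≤ q * (2 * A * r) := by linarith
      have h2 := le_of_mul_le_mul_left h1 h0
      rw [div_mul_eq_mul_div, div_mul_eq_mul_div, le_div_iff₀ hc]
      linarith
  constructor
  · calc l1 h ≤ 6 * (r * q) := hcone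
      _ ≤ 6 * (r * (4 / c * A * r)) := by gcongr
      _ = 24 / c * A * s := by rw [← hrr]; ring
  · calc Q ≤ 2 * (A * (r * q)) := hQ1
      _ ≤ 2 * (A * (r * (4 / c * A * r))) := by gcongr
      _ = _ := by rw [← hrr]; ring

end Lasso

end GraphLasso

namespace GraphLasso

/-! ### The one-step estimator and its studentization -/

section OneStep

variable {N n : ℕ} (X : Matrix (Fin N) (Fin n) ℝ) (Θ : Matrix (Fin n) (Fin n) ℝ)

theorem mul_sampleCov_apply (a b : Fin n) :
    (Θ * sampleCov X) a b = 1 / (N : ℝ) * ∑ i, (X * Θᵀ) i a * X i b := by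
  have h : (Θ * sampleCov X) = (1 / (N : ℝ)) • ((X * Θᵀ)ᵀ * X) := by
    rw [sampleCov, Matrix.mul_smul, transpose_mul, transpose_transpose, Matrix.mul_assoc]
  rw [h, Matrix.smul_apply, smul_eq_mul, mul_apply]
  rfl

theorem sampleCov_apply (a b : Fin n) :
    sampleCov X a b = 1 / (N : ℝ) * ∑ i, X i a * X i b := by
  rw [sampleCov, Matrix.smul_apply, smul_eq_mul, mul_apply]
  rfl

theorem mul_sampleCov_mul_transpose_apply (j : Fin n) :
    (Θ * sampleCov X * Θᵀ) j j = 1 / (N : ℝ) * ∑ i, (X * Θᵀ) i j ^ 2 := by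
  have h : (Θ * sampleCov X * Θᵀ) = (1 / (N : ℝ)) • ((X * Θᵀ)ᵀ * (X * Θᵀ)) := by
    rw [sampleCov, Matrix.mul_smul, Matrix.smul_mul, transpose_mul, transpose_transpose]
    simp only [Matrix.mul_assoc]
  rw [h, Matrix.smul_apply, smul_eq_mul, mul_apply]
  congr 1
  exact Finset.sum_congr rfl fun i _ => (sq _).symm

variable {X Θ}

/-- The asymptotic variance of a feasible CLIME row is bounded below. -/
theorem ClimeFeasible.variance_lower_bound {mu B : ℝ} (h : ClimeFeasible X mu Θ) (hmu : mu ≤ 1 / 2)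
    {j : Fin n} (hB : sampleCov X j j ≤ B) (hB0 : 0 < B) :
    1 / (4 * B) ≤ (Θ * sampleCov X * Θᵀ) j j := by
  have h1 := (abs_le.1 (h j j)).1
  rw [Matrix.sub_apply, one_apply_eq] at h1
  have h2 : 1 / 2 ≤ (Θ * sampleCov X) j j := by linarith
  rw [mul_sampleCov_apply] at h2
  -- The diagonal entry (Θ Σ_N)_jj ≥ 1/2 is the empirical inner product of the columns (X Θᵀ)_j and
  -- X_j, so Cauchy-Schwarz forces the first of them to be large.
  have hcs := Finset.sum_mul_sq_le_sq_mul_sq Finset.univ (fun i => (X * Θᵀ) i j) (fun i => X i j)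
  rw [mul_sampleCov_mul_transpose_apply]
  set p := 1 / (N : ℝ) * ∑ i, (X * Θᵀ) i j ^ 2 with hp
  have hp0 : 0 ≤ p := mul_nonneg (by positivity) (Finset.sum_nonneg fun _ _ => sq_nonneg _)
  have h3 : (1 / 2) ^ 2 ≤ p * sampleCov X j j := by
    calc (1 / 2 : ℝ) ^ 2 ≤ (1 / (N : ℝ) * ∑ i, (X * Θᵀ) i j * X i j) ^ 2 := by gcongr
      _ = (1 / (N : ℝ)) ^ 2 * (∑ i, (X * Θᵀ) i j * X i j) ^ 2 := by ring
      _ ≤ (1 / (N : ℝ)) ^ 2 * ((∑ i, (X * Θᵀ) i j ^ 2) * ∑ i, X i j ^ 2) := by gcongr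
      _ = p * sampleCov X j j := by
          rw [sampleCov_apply, hp]
          simp only [sq]
          ring
  have h4 : p * sampleCov X j j ≤ p * B := by gcongr
  rw [div_le_iff₀ (by positivity)]
  linarith

/-- The algebraic core of debiasing: the initial error survives only through Θ Σ_N - I, whose
entries the CLIME constraint makes small. -/
theorem oneStep_sub (β b : Fin n → ℝ) (ε : Fin N → ℝ) (j : Fin n) :
    oneStep X (response X β ε) Θ b j - β j
      = 1 / (N : ℝ) * ∑ i, (X * Θᵀ) i j * ε i - ((Θ * sampleCov X - 1) *ᵥ (b - β)) j := by
  have h1 : (Θ * sampleCov X - 1) *ᵥ (b - β)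
      = (1 / (N : ℝ)) • (Θ *ᵥ (Xᵀ *ᵥ (X *ᵥ (b - β)))) - (b - β) := by
    rw [sub_mulVec, one_mulVec, sampleCov, Matrix.mul_smul, smul_mulVec]
    simp only [mulVec_mulVec]
  have h2 : ∑ i, (X * Θᵀ) i j * ε i = (Θ *ᵥ (Xᵀ *ᵥ ε)) j := by
    have : Θ *ᵥ (Xᵀ *ᵥ ε) = (X * Θᵀ)ᵀ *ᵥ ε := by
      rw [transpose_mul, transpose_transpose, mulVec_mulVec]
    rw [this]
    rfl
  rw [h1, h2, oneStep, response_sub_mulVec, mulVec_sub, mulVec_sub]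
  simp only [Pi.add_apply, Pi.smul_apply, Pi.sub_apply, smul_eq_mul]
  ring

theorem ClimeFeasible.abs_mulVec_le {mu : ℝ} (h : ClimeFeasible X mu Θ) (v : Fin n → ℝ)
    (j : Fin n) : |((Θ * sampleCov X - 1) *ᵥ v) j| ≤ mu * l1 v := by
  calc |∑ b, (Θ * sampleCov X - 1) j b * v b|
      ≤ ∑ b, |(Θ * sampleCov X - 1) j b * v b| := Finset.abs_sum_le_sum_abs _ _
    _ ≤ ∑ b, mu * |v b| := by
        refine Finset.sum_le_sum fun b _ => ?_
        rw [abs_mul]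
        gcongr
        exact h j b
    _ = mu * l1 v := by rw [← Finset.mul_sum, l1]

theorem abs_sqrt_sum_sq_sub_le (u v : Fin N → ℝ) :
    |√(1 / (N : ℝ) * ∑ i, (u i - v i) ^ 2) - √(1 / (N : ℝ) * ∑ i, u i ^ 2)|
      ≤ √(1 / (N : ℝ) * ∑ i, v i ^ 2) := by
  have h0 : (0 : ℝ) ≤ 1 / N := by positivity
  rw [Real.sqrt_mul h0, Real.sqrt_mul h0, Real.sqrt_mul h0, ← mul_sub, abs_mul,
    abs_of_nonneg (Real.sqrt_nonneg _)]
  gcongr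
  have := abs_norm_sub_norm_le (WithLp.toLp 2 (u - v)) (WithLp.toLp 2 u : EuclideanSpace ℝ (Fin N))
  rw [← WithLp.toLp_sub, sub_sub_cancel_left] at this
  simpa [EuclideanSpace.norm_eq] using this

/-- The residual standard deviation differs from the one of the noise by at most the prediction
error. -/
theorem abs_residualStd_sub_le (β b : Fin n → ℝ) (ε : Fin N → ℝ) :
    |residualStd X (response X β ε) b - √(1 / (N : ℝ) * ∑ i, ε i ^ 2)|
      ≤ √(1 / (N : ℝ) * ∑ i, (X *ᵥ (b - β)) i ^ 2) := by
  have e1 : ∀ i, response X β ε i - (X *ᵥ b) i = ε i - (X *ᵥ (b - β)) i := fun i =>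
    congrFun (response_sub_mulVec X β b ε) i
  simp only [residualStd, e1]
  exact abs_sqrt_sum_sq_sub_le _ _

/-- The vector `v` scaled to Euclidean norm one; a constant vector if `v = 0`. -/
noncomputable def unitWeight (v : Fin N → ℝ) (i : Fin N) : ℝ :=
  if ∑ i, v i ^ 2 = 0 then 1 / √(N : ℝ) else v i / √(∑ i, v i ^ 2)

/-- The fallback for v = 0 makes this hold without exception, so the leading term is exactly
Gaussian even on designs where the relevant row degenerates. -/
theorem sum_unitWeight_sq (hN : 0 < N) (v : Fin N → ℝ) : ∑ i, unitWeight v i ^ 2 = 1 := by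
  unfold unitWeight
  have hN' : (0 : ℝ) < N := Nat.cast_pos.2 hN
  have h0 : 0 ≤ ∑ i, v i ^ 2 := Finset.sum_nonneg fun _ _ => sq_nonneg _
  split_ifs with h
  · simp [hN'.ne']
  · simp only [div_pow, Real.sq_sqrt h0, ← Finset.sum_div]
    exact div_self h

theorem measurable_unitWeight (i : Fin N) : Measurable fun v : Fin N → ℝ => unitWeight v i := by
  unfold unitWeight
  refine Measurable.ite ?_ (by fun_prop) (by fun_prop)
  exact (measurableSet_singleton (0 : ℝ)).preimage (by fun_prop)

/-- Linear combinations with the weights `v` in terms of the normalized weights. -/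
theorem sum_mul_eq_sqrt_mul_sum_unitWeight (v ε : Fin N → ℝ) {σ : ℝ} (hσ : 0 < σ) :
    ∑ i, v i * ε i = √(∑ i, v i ^ 2) * σ * ∑ i, unitWeight v i * (ε i / σ) := by
  by_cases h : ∑ i, v i ^ 2 = 0
  · have hv : ∀ i, v i = 0 := fun i => by
      have := (Finset.sum_eq_zero_iff_of_nonneg (fun i _ => sq_nonneg (v i))).1 h i
        (Finset.mem_univ _)
      exact pow_eq_zero_iff two_ne_zero |>.1 this
    simp [hv]
  · have h0 : 0 < √(∑ i, v i ^ 2) := Real.sqrt_pos.2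
      (lt_of_le_of_ne (Finset.sum_nonneg fun _ _ => sq_nonneg _) (Ne.symm h))
    rw [Finset.mul_sum]
    refine Finset.sum_congr rfl fun i _ => ?_
    rw [unitWeight, if_neg h]
    field_simp

/-- The standard Gaussian leading term of the studentized statistic. -/
noncomputable def leadingTerm (X : Matrix (Fin N) (Fin n) ℝ) (Θ : Matrix (Fin n) (Fin n) ℝ)
    (j : Fin n) (σ : ℝ) (ε : Fin N → ℝ) : ℝ :=
  ∑ i, unitWeight (fun i => (X * Θᵀ) i j) i * (ε i / σ)

/-- With ρ = σ̂ / σ and R the standardized bias, the statistic minus its leading term Z is (Z (1 -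
ρ) - R) / ρ. The final factor 2 comes from ρ ≥ 1/2. -/
theorem abs_studentized_sub_leadingTerm_le (hN : 0 < N) {σ : ℝ} (hσ : 0 < σ) {β b : Fin n → ℝ}
    {ε : Fin N → ℝ} {j : Fin n} {B κ₁ κ₂ ω mu : ℝ} (hω : 0 < ω)
    (hfeas : ClimeFeasible X mu Θ) (hvar : ω ≤ (Θ * sampleCov X * Θᵀ) j j)
    (hZ : |leadingTerm X Θ j σ ε| ≤ B)
    (hκ₁ : |residualStd X (response X β ε) b / σ - 1| ≤ κ₁) (hκ : κ₁ ≤ 1 / 2)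
    (hκ₂ : √(N : ℝ) * (mu * l1 (b - β)) ≤ κ₂ * (σ * √ω)) :
    |studentized X (response X β ε) Θ b β j - leadingTerm X Θ j σ ε| ≤ 2 * (B * κ₁ + κ₂) := by
  have hN' : (0 : ℝ) < N := Nat.cast_pos.2 hN
  set Z := leadingTerm X Θ j σ ε with hZdef
  set s := residualStd X (response X β ε) b with hs
  set V := (Θ * sampleCov X * Θᵀ) j j with hV
  set e := ((Θ * sampleCov X - 1) *ᵥ (b - β)) j with he
  have hV0 : 0 < V := hω.trans_le hvar
  have hsV : 0 < √V := Real.sqrt_pos.2 hV0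
  have hsN : 0 < √(N : ℝ) := Real.sqrt_pos.2 hN'
  have hNN : √(N : ℝ) * √(N : ℝ) = N := Real.mul_self_sqrt hN'.le
  have hnum : √(N : ℝ) * (oneStep X (response X β ε) Θ b j - β j)
      = √V * σ * Z - √(N : ℝ) * e := by
    have h1 : √(∑ i, (X * Θᵀ) i j ^ 2) = √(N : ℝ) * √V := by
      rw [hV, mul_sampleCov_mul_transpose_apply, ← Real.sqrt_mul hN'.le]
      congr 1
      field_simp
    rw [oneStep_sub, sum_mul_eq_sqrt_mul_sum_unitWeight _ _ hσ, h1, ← he]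
    change √(N : ℝ) * (1 / (N : ℝ) * (√(N : ℝ) * √V * σ * Z) - e) = _
    have : √(N : ℝ) * (1 / (N : ℝ) * (√(N : ℝ) * √V * σ * Z))
        = (√(N : ℝ) * √(N : ℝ)) / N * (√V * σ * Z) := by ring
    rw [mul_sub, this, hNN, div_self hN'.ne', one_mul]
  set ρ := s / σ with hρ
  have hρ1 := abs_le.1 hκ₁
  have hρ0 : 1 / 2 ≤ ρ := by linarith
  have hsρ : s = ρ * σ := by rw [hρ]; field_simp
  set R := √(N : ℝ) * e / (σ * √V) with hR
  have hRb : |R| ≤ κ₂ := by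
    rw [hR, abs_div, abs_of_pos (mul_pos hσ hsV), div_le_iff₀ (mul_pos hσ hsV), abs_mul,
      abs_of_pos hsN]
    have h1 : √(N : ℝ) * |e| ≤ √(N : ℝ) * (mu * l1 (b - β)) := by
      gcongr; exact hfeas.abs_mulVec_le _ _
    have h2 : 0 ≤ κ₂ := by
      have h3 : 0 ≤ κ₂ * (σ * √ω) := le_trans (by positivity) (h1.trans hκ₂)
      exact nonneg_of_mul_nonneg_left h3 (mul_pos hσ (Real.sqrt_pos.2 hω))
    calc _ ≤ _ := h1.trans hκ₂
      _ ≤ _ := by gcongr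
  have hT : studentized X (response X β ε) Θ b β j - Z = (Z * (1 - ρ) - R) / ρ := by
    have hρ' : ρ ≠ 0 := by linarith
    rw [studentized, hnum, ← hs, ← hV, hsρ, hR]
    field_simp
    ring
  rw [hT, abs_div, abs_of_pos (by linarith : 0 < ρ), div_le_iff₀ (by linarith)]
  have hB0 : 0 ≤ B := (abs_nonneg Z).trans hZ
  have hκ₁0 : 0 ≤ κ₁ := (abs_nonneg _).trans hκ₁
  have hκ₂0 : 0 ≤ κ₂ := (abs_nonneg _).trans hRb
  have h1 : |Z * (1 - ρ)| ≤ B * κ₁ := by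
    rw [abs_mul, abs_sub_comm 1 ρ]
    gcongr
  calc |Z * (1 - ρ) - R| ≤ |Z * (1 - ρ)| + |R| := abs_sub _ _
    _ ≤ B * κ₁ + κ₂ := by linarith
    _ = 2 * (B * κ₁ + κ₂) * (1 / 2) := by ring
    _ ≤ _ := by gcongr

end OneStep

/-! ### Measurability of the studentized statistic. -/

section Measurability

variable {Ω : Type*} [MeasurableSpace Ω] {P : Measure Ω} {N n : ℕ}

theorem aemeasurable_mulVec {m k : Type*} [Fintype k] {A : Ω → Matrix m k ℝ} {v : Ω → k → ℝ}
    (hA : ∀ i a, AEMeasurable (fun ω => A ω i a) P) (hv : ∀ a, AEMeasurable (fun ω => v ω a) P)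
    (i : m) : AEMeasurable (fun ω => (A ω *ᵥ v ω) i) P :=
  Finset.aemeasurable_fun_sum _ fun a _ => (hA i a).mul (hv a)

theorem aemeasurable_matrix_mul {l m k : Type*} [Fintype m] {A : Ω → Matrix l m ℝ}
    {B : Ω → Matrix m k ℝ} (hA : ∀ i a, AEMeasurable (fun ω => A ω i a) P)
    (hB : ∀ i a, AEMeasurable (fun ω => B ω i a) P) (i : l) (a : k) :
    AEMeasurable (fun ω => (A ω * B ω) i a) P :=
  Finset.aemeasurable_fun_sum _ fun c _ => (hA i c).mul (hB c a)

variable {X : Ω → Matrix (Fin N) (Fin n) ℝ} {ε : Ω → Fin N → ℝ}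
  {Θ : Ω → Matrix (Fin n) (Fin n) ℝ} {b : Ω → Fin n → ℝ}

theorem aemeasurable_residual (β : Fin n → ℝ) (hX : ∀ i a, AEMeasurable (fun ω => X ω i a) P)
    (hε : ∀ i, AEMeasurable (fun ω => ε ω i) P) (hb : ∀ a, AEMeasurable (fun ω => b ω a) P)
    (i : Fin N) : AEMeasurable (fun ω => (response (X ω) β (ε ω) - X ω *ᵥ b ω) i) P := by
  have h := ((aemeasurable_mulVec hX (fun a => aemeasurable_const (b := β a)) i).add (hε i)).sub
    (aemeasurable_mulVec hX hb i)
  exact h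

theorem aemeasurable_residualStd (β : Fin n → ℝ) (hX : ∀ i a, AEMeasurable (fun ω => X ω i a) P)
    (hε : ∀ i, AEMeasurable (fun ω => ε ω i) P) (hb : ∀ a, AEMeasurable (fun ω => b ω a) P) :
    AEMeasurable (fun ω => residualStd (X ω) (response (X ω) β (ε ω)) (b ω)) P := by
  have h := ((Finset.aemeasurable_fun_sum Finset.univ fun i _ =>
    (aemeasurable_residual β hX hε hb i).pow_const 2).const_mul (1 / (N : ℝ))).sqrt
  exact h

theorem aemeasurable_variance (hX : ∀ i a, AEMeasurable (fun ω => X ω i a) P)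
    (hΘ : ∀ a c, AEMeasurable (fun ω => Θ ω a c) P) (j : Fin n) :
    AEMeasurable (fun ω => (Θ ω * sampleCov (X ω) * (Θ ω)ᵀ) j j) P := by
  simp only [mul_sampleCov_mul_transpose_apply]
  have hΘt : ∀ a c, AEMeasurable (fun ω => (Θ ω)ᵀ a c) P := fun a c => hΘ c a
  exact (Finset.aemeasurable_fun_sum _ fun i _ =>
    (aemeasurable_matrix_mul hX hΘt i j).pow_const 2).const_mul _

theorem aemeasurable_oneStep (β : Fin n → ℝ) (j : Fin n)
    (hX : ∀ i a, AEMeasurable (fun ω => X ω i a) P) (hε : ∀ i, AEMeasurable (fun ω => ε ω i) P)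
    (hΘ : ∀ a c, AEMeasurable (fun ω => Θ ω a c) P) (hb : ∀ a, AEMeasurable (fun ω => b ω a) P) :
    AEMeasurable (fun ω => oneStep (X ω) (response (X ω) β (ε ω)) (Θ ω) (b ω) j) P := by
  have hXt : ∀ a i, AEMeasurable (fun ω => (X ω)ᵀ a i) P := fun a i => hX i a
  have h1 := aemeasurable_mulVec hXt (aemeasurable_residual β hX hε hb)
  have h2 := aemeasurable_mulVec hΘ h1 j
  have h := (hb j).add (h2.const_mul (1 / (N : ℝ)))
  exact h

theorem aemeasurable_studentized (β : Fin n → ℝ) (j : Fin n)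
    (hX : ∀ i a, AEMeasurable (fun ω => X ω i a) P) (hε : ∀ i, AEMeasurable (fun ω => ε ω i) P)
    (hΘ : ∀ a c, AEMeasurable (fun ω => Θ ω a c) P) (hb : ∀ a, AEMeasurable (fun ω => b ω a) P) :
    AEMeasurable (fun ω => studentized (X ω) (response (X ω) β (ε ω)) (Θ ω) (b ω) β j) P := by
  have h := (((aemeasurable_oneStep β j hX hε hΘ hb).sub_const (β j)).const_mul √(N : ℝ)).div
    ((aemeasurable_residualStd β hX hε hb).mul (aemeasurable_variance hX hΘ j).sqrt)
  exact h

end Measurability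

end GraphLasso

namespace GraphLasso

/-! ### Symmetric matrices with bounded spectrum -/

section Spectrum

variable {n : ℕ} {S : Matrix (Fin n) (Fin n) ℝ} {c c' : ℝ}

theorem isHermitian_of_symm (hS : ∀ a b, S a b = S b a) : S.IsHermitian := by
  ext a b
  simp [hS b a]

theorem le_quadratic_of_spectrum (hS : ∀ a b, S a b = S b a)
    (hspec : spectrum ℝ S ⊆ Set.Icc c c') (v : Fin n → ℝ) :
    c * ∑ a, v a ^ 2 ≤ v ⬝ᵥ (S *ᵥ v) := by
  have hH : (S - algebraMap ℝ _ c).IsHermitian := by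
    refine isHermitian_of_symm fun a b => ?_
    by_cases h : a = b
    · rw [h]
    · simp [algebraMap_matrix_apply, h, Ne.symm h, hS a b]
  -- Subtracting c I shifts the spectrum by c, so all eigenvalues become nonnegative.
  have hpsd : (S - algebraMap ℝ _ c).PosSemidef := by
    rw [hH.posSemidef_iff_eigenvalues_nonneg]
    intro i
    have h1 := hH.eigenvalues_mem_spectrum_real i
    have h2 : hH.eigenvalues i + c ∈ spectrum ℝ S := by
      rw [spectrum.mem_iff] at h1 ⊢
      convert h1 using 2
      rw [map_add]
      abel
    have := (hspec h2).1
    simp only [Pi.zero_apply]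
    linarith
  have h := hpsd.dotProduct_mulVec_nonneg v
  rw [star_trivial, sub_mulVec, dotProduct_sub, Algebra.algebraMap_eq_smul_one,
    smul_mulVec, one_mulVec,
    dotProduct_smul, smul_eq_mul] at h
  have h2 : v ⬝ᵥ v = ∑ a, v a ^ 2 := Finset.sum_congr rfl fun a _ => (sq _).symm
  rw [h2] at h
  linarith

theorem apply_self_le_of_spectrum (hS : ∀ a b, S a b = S b a)
    (hspec : spectrum ℝ S ⊆ Set.Icc c c') (a : Fin n) : S a a ≤ c' := by
  have hspec' : spectrum ℝ (-S) ⊆ Set.Icc (-c') (-c) := by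
    rw [← spectrum.neg_eq]
    intro x hx
    have := hspec hx
    simp only [Set.mem_Icc] at this ⊢
    constructor <;> linarith [this.1, this.2]
  have h := le_quadratic_of_spectrum (S := -S) (fun a b => by simp [hS a b]) hspec' (Pi.single a 1)
  simp only [mulVec_single_one, single_dotProduct, Pi.single_apply, ite_pow, one_pow] at h
  simp at h
  exact h

theorem isUnit_det_of_quadratic (hc : 0 < c)
    (h : ∀ v : Fin n → ℝ, c * ∑ a, v a ^ 2 ≤ v ⬝ᵥ (S *ᵥ v)) : IsUnit S.det := by
  rw [isUnit_iff_ne_zero]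
  intro h0
  obtain ⟨v, hv, hv0⟩ := exists_mulVec_eq_zero_iff.2 h0
  have h1 := h v
  rw [hv0, dotProduct_zero] at h1
  have h2 : ∑ a, v a ^ 2 ≤ 0 := by nlinarith
  have h3 : ∑ a, v a ^ 2 = 0 := le_antisymm h2 (Finset.sum_nonneg fun _ _ => sq_nonneg _)
  rw [Finset.sum_eq_zero_iff_of_nonneg fun _ _ => sq_nonneg _] at h3
  exact hv (funext fun a => pow_eq_zero_iff two_ne_zero |>.1 (h3 a (Finset.mem_univ a)))

theorem mulVec_inv_row (hS : ∀ a b, S a b = S b a) (hu : IsUnit S.det) (a : Fin n) :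
    S *ᵥ (fun b => S⁻¹ a b) = Pi.single a 1 := by
  ext b
  have h : (S⁻¹ * S) a b = (1 : Matrix (Fin n) (Fin n) ℝ) a b := by rw [nonsing_inv_mul S hu]
  rw [mul_apply, one_apply] at h
  simp only [mulVec, dotProduct, Pi.single_apply]
  rw [show (if b = a then (1 : ℝ) else 0) = if a = b then 1 else 0 by simp [eq_comm], ← h]
  exact Finset.sum_congr rfl fun x _ => by rw [hS b x, mul_comm]

theorem quadratic_inv_row (hS : ∀ a b, S a b = S b a) (hu : IsUnit S.det) (a : Fin n) :
    (fun b => S⁻¹ a b) ⬝ᵥ (S *ᵥ fun b => S⁻¹ a b) = S⁻¹ a a := by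
  rw [mulVec_inv_row hS hu, dotProduct_single, mul_one]

/-- For the row θ = S⁻¹_a the quadratic form θᵀSθ is just S⁻¹_aa, hence c‖θ‖² ≤ S⁻¹_aa ≤ ‖θ‖. This
controls the sub-Gaussian parameter of θᵀX_i. -/
theorem sum_sq_inv_row_le (hc : 0 < c) (hS : ∀ a b, S a b = S b a)
    (hspec : spectrum ℝ S ⊆ Set.Icc c c') (a : Fin n) :
    ∑ b, S⁻¹ a b ^ 2 ≤ 1 / c ^ 2 := by
  have hq := le_quadratic_of_spectrum hS hspec
  have h1 := hq fun b => S⁻¹ a b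
  rw [quadratic_inv_row hS (isUnit_det_of_quadratic hc hq)] at h1
  set q := ∑ b, S⁻¹ a b ^ 2 with hqd
  have h2 : S⁻¹ a a ^ 2 ≤ q :=
    Finset.single_le_sum (f := fun b => S⁻¹ a b ^ 2) (fun _ _ => sq_nonneg _) (Finset.mem_univ a)
  have hq0 : 0 ≤ q := Finset.sum_nonneg fun _ _ => sq_nonneg _
  have h3 : (c * q) ^ 2 ≤ S⁻¹ a a ^ 2 := by gcongr
  rw [le_div_iff₀ (by positivity)]
  rcases hq0.eq_or_lt with h0 | h0
  · rw [← h0]; simp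
  · have h4 : q * (q * c ^ 2) ≤ q * 1 := by linarith
    exact le_of_mul_le_mul_left h4 h0

/-- The quadratic form of S at S⁻¹_a - e_a / c' is nonnegative; it equals S⁻¹_aa - 2/c' + S_aa /
c'², and S_aa ≤ c'. The bound keeps M_n away from zero. -/
theorem le_inv_apply_self (hc : 0 < c) (hc' : 0 < c') (hS : ∀ a b, S a b = S b a)
    (hspec : spectrum ℝ S ⊆ Set.Icc c c') (a : Fin n) : 1 / c' ≤ S⁻¹ a a := by
  have hq := le_quadratic_of_spectrum hS hspec
  have hu := isUnit_det_of_quadratic hc hq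
  have h1 := hq ((fun b => S⁻¹ a b) - Pi.single a (1 / c'))
  have h0 : 0 ≤ c * ∑ b, ((fun b => S⁻¹ a b) - Pi.single a (1 / c') : Fin n → ℝ) b ^ 2 :=
    mul_nonneg hc.le (Finset.sum_nonneg fun _ _ => sq_nonneg _)
  have h2 := apply_self_le_of_spectrum hS hspec a
  have h3 : (fun b => S⁻¹ a b) ⬝ᵥ (S *ᵥ Pi.single a (1 / c')) = 1 / c' := by
    have h := congrFun (mulVec_inv_row hS hu a) a
    simp only [mulVec, dotProduct, Pi.single_eq_same] at h
    simp only [mulVec_single, dotProduct, col_apply, Pi.smul_apply, MulOpposite.smul_eq_mul_unop,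
      MulOpposite.unop_op]
    simp_rw [← mul_assoc, ← Finset.sum_mul]
    have h' : ∑ x, S⁻¹ a x * S x a = 1 := by
      rw [← h]
      exact Finset.sum_congr rfl fun b _ => by rw [hS a b, mul_comm]
    rw [h', one_mul]
  rw [mulVec_sub, dotProduct_sub, sub_dotProduct, sub_dotProduct, quadratic_inv_row hS hu, h3,
    mulVec_inv_row hS hu, dotProduct_single, Pi.single_eq_same] at h1
  have h4 : (Pi.single a (1 / c') : Fin n → ℝ) ⬝ᵥ (S *ᵥ Pi.single a (1 / c'))
      = 1 / c' * (S a a * (1 / c')) := by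
    simp [mulVec_single, mul_assoc]
  rw [h4] at h1
  have h5 : 1 / c' * (S a a * (1 / c')) ≤ 1 / c' * (c' * (1 / c')) := by gcongr
  rw [mul_one_div_cancel hc'.ne', mul_one] at h5
  linarith

end Spectrum

/-! ### Uniform concentration -/

section Concentration

variable {Ω : Type*} [MeasurableSpace Ω] {P : Measure Ω}

theorem hasSubgaussianMGF_mono {Y : Ω → ℝ} {c c' : NNReal} (h : HasSubgaussianMGF Y c P)
    (hc : c ≤ c') : HasSubgaussianMGF Y c' P :=
  ⟨h.integrable_exp_mul, fun t => (h.mgf_le t).trans (Real.exp_le_exp.2 (by gcongr))⟩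

theorem hasSubgaussianMGF_of_hasLaw {Z : Ω → ℝ} (h : HasLaw Z (gaussianReal 0 1) P) :
    HasSubgaussianMGF Z 1 P := by
  refine ⟨fun t => ?_, fun t => ?_⟩
  · have := integrable_exp_mul_gaussianReal (μ := 0) (v := 1) t
    rw [← h.map_eq] at this
    exact this.comp_aemeasurable h.aemeasurable
  · rw [mgf_gaussianReal h.map_eq]
    simp

theorem measureReal_abs_ge_le_of_hasLaw [IsProbabilityMeasure P] {Z : Ω → ℝ}
    (h : HasLaw Z (gaussianReal 0 1) P) {x : ℝ} (hx : 0 ≤ x) :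
    P.real {ω | x ≤ |Z ω|} ≤ 2 * Real.exp (-(x ^ 2 / 2)) := by
  have hs := hasSubgaussianMGF_of_hasLaw h
  have h1 := hs.measure_ge_le hx
  have h2 := hs.neg.measure_ge_le hx
  have hsub : {ω | x ≤ |Z ω|} ⊆ {ω | x ≤ Z ω} ∪ {ω | x ≤ (-Z) ω} := by
    intro ω hω
    simp only [Set.mem_ofPred_eq, Set.mem_union, Pi.neg_apply] at hω ⊢
    exact le_abs.1 hω
  have h3 : -x ^ 2 / (2 * ((1 : NNReal) : ℝ)) = -(x ^ 2 / 2) := by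
    rw [NNReal.coe_one]; ring
  rw [h3] at h1 h2
  calc _ ≤ _ := (measureReal_mono hsub).trans (measureReal_union_le _ _)
    _ ≤ _ := by linarith

theorem measureReal_exists_le {ι : Type*} [Fintype ι] {p : ι → Ω → Prop}
    {B : ℝ} (h : ∀ i, P.real {ω | p i ω} ≤ B) :
    P.real {ω | ∃ i, p i ω} ≤ Fintype.card ι * B := by
  have h1 : {ω | ∃ i, p i ω} = ⋃ i, {ω | p i ω} := by ext; simp
  rw [h1]
  refine (measureReal_iUnion_fintype_le _).trans ((Finset.sum_le_sum fun i _ => h i).trans ?_)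
  simp

/-- Maximal inequality for Gaussian linear combinations with random unit weights. -/
theorem IsGaussianNoise.measureReal_exists_ge_le [IsProbabilityMeasure P] {α : Type*}
    [MeasurableSpace α] {N n : ℕ} {σ : ℝ} {ε : Ω → Fin N → ℝ} (h : IsGaussianNoise σ ε P)
    (hσ : 0 < σ) {X : Ω → α} (hX : Measurable X) (hind : IndepFun X ε P)
    {w : Fin n → α → Fin N → ℝ} (hwm : ∀ a i, Measurable fun x => w a x i)
    (hw : ∀ a x, ∑ i, w a x i ^ 2 = 1) (hn : 0 < n) {x q : ℝ} (hx : 0 ≤ x)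
    (hq : 1 + q ≤ x ^ 2 / 2) :
    P.real {ω | ∃ a, x * √(Real.log n) ≤ |∑ i, w a (X ω) i * (ε ω i / σ)|}
      ≤ 2 * Real.exp (-(q * Real.log n)) := by
  have hn' : (0 : ℝ) < n := Nat.cast_pos.2 hn
  have hlog : 0 ≤ Real.log n := Real.log_natCast_nonneg n
  refine (measureReal_exists_le fun a => measureReal_abs_ge_le_of_hasLaw
    (h.hasLaw_sum_random hσ hX hind (hwm a) (hw a)) (by positivity)).trans ?_
  rw [mul_pow, Real.sq_sqrt hlog, Fintype.card_fin]
  calc (n : ℝ) * (2 * Real.exp (-(x ^ 2 * Real.log n / 2)))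
      = 2 * (Real.exp (Real.log n) * Real.exp (-(x ^ 2 * Real.log n / 2))) := by
        rw [Real.exp_log hn']; ring
    _ ≤ _ := by
        rw [← Real.exp_add]
        gcongr
        nlinarith

theorem le_abs_average_sub_iff {N : ℕ} (hN : 0 < N) (f : Fin N → ℝ) (m u : ℝ) :
    u ≤ |1 / (N : ℝ) * ∑ i, f i - m| ↔ N * u ≤ |∑ i, (f i - m)| := by
  have hN' : (0 : ℝ) < N := Nat.cast_pos.2 hN
  have : 1 / (N : ℝ) * ∑ i, f i - m = (∑ i, (f i - m)) / N := by
    rw [Finset.sum_sub_distrib]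
    simp only [Finset.sum_const, Finset.card_univ, Fintype.card_fin, nsmul_eq_mul]
    field_simp
  rw [this, abs_div, abs_of_pos hN', le_div_iff₀ hN', mul_comm]

/-- In the exponent 2 + q, the 2 pays for a union bound over n² matrix entries and q is the
remaining decay n^(-q). -/
theorem sq_mul_exp_neg_le {N n : ℕ} (hN : 0 < N) (hn : 0 < n) {C τ q : ℝ} (hC : 0 < C)
    (hq : (2 + q) * C ≤ τ ^ 2) :
    (n : ℝ) ^ 2 * (2 * Real.exp (-(N * (τ * √(Real.log n / N)) ^ 2 / C)))
      ≤ 2 * Real.exp (-(q * Real.log n)) := by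
  have hn' : (0 : ℝ) < n := Nat.cast_pos.2 hn
  have hlog : 0 ≤ Real.log n := Real.log_natCast_nonneg n
  have h1 : N * (τ * √(Real.log n / N)) ^ 2 / C = τ ^ 2 / C * Real.log n := by
    rw [mul_pow, Real.sq_sqrt (by positivity)]
    field_simp
  have h2 : (n : ℝ) ^ 2 = Real.exp (2 * Real.log n) := by
    rw [two_mul, Real.exp_add, Real.exp_log hn', sq]
  have h3 : 2 + q ≤ τ ^ 2 / C := by rwa [le_div_iff₀ hC]
  rw [h1, h2, mul_left_comm, ← Real.exp_add]
  have h4 : 2 * Real.log n + -(τ ^ 2 / C * Real.log n) ≤ -(q * Real.log n) := by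
    have := mul_le_mul_of_nonneg_right h3 hlog
    linarith
  have := Real.exp_le_exp.2 h4
  linarith

/-- Uniform Bernstein inequality for the entries of a matrix of empirical second moments. -/
theorem exists_uniform_bernstein {c : NNReal} (hc : 0 < c) :
    ∃ C > (0 : ℝ), ∃ u₀ > (0 : ℝ), ∀ {Ω : Type*} [MeasurableSpace Ω] {P : Measure Ω}
      [IsProbabilityMeasure P] {N n : ℕ} {U V : Fin n → Fin N → Ω → ℝ} {m : Fin n → Fin n → ℝ},
      0 < N → 0 < n → (∀ a b, iIndepFun (fun i ω => U a i ω * V b i ω) P) →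
      (∀ a i, HasSubgaussianMGF (U a i) c P) → (∀ a i, HasSubgaussianMGF (V a i) c P) →
      (∀ a b i, ∫ ω, U a i ω * V b i ω ∂P = m a b) →
      ∀ {τ q : ℝ}, 0 ≤ τ → (2 + q) * C ≤ τ ^ 2 → τ * √(Real.log n / N) ≤ u₀ →
        P.real {ω | ∃ a b, τ * √(Real.log n / N) ≤
            |1 / (N : ℝ) * ∑ i, U a i ω * V b i ω - m a b|}
          ≤ 2 * Real.exp (-(q * Real.log n)) := by
  obtain ⟨C, hC, u₀, hu₀, hB⟩ := exists_bernstein_mul hc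
  refine ⟨C, hC, u₀, hu₀, ?_⟩
  intro Ω _ P _ N n U V m hN hn hind hU hV hm τ q hτ hq hτu
  have hr0 : 0 ≤ τ * √(Real.log n / N) := mul_nonneg hτ (Real.sqrt_nonneg _)
  have h1 : ∀ p : Fin n × Fin n, P.real {ω | τ * √(Real.log n / N) ≤
      |1 / (N : ℝ) * ∑ i, U p.1 i ω * V p.2 i ω - m p.1 p.2|}
      ≤ 2 * Real.exp (-(N * (τ * √(Real.log n / N)) ^ 2 / C)) := fun p => by
    simp only [le_abs_average_sub_iff hN]
    exact hB (hind p.1 p.2) (hU p.1) (hV p.2) (hm p.1 p.2) hr0 hτu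
  have h2 := measureReal_exists_le h1
  simp only [Prod.exists, Fintype.card_prod, Fintype.card_fin, Nat.cast_mul] at h2
  rw [← sq] at h2
  exact h2.trans (sq_mul_exp_neg_le hN hn hC hq)

theorem IsGaussianNoise.hasLaw_div {N : ℕ} {σ : ℝ} {ε : Ω → Fin N → ℝ}
    (h : IsGaussianNoise σ ε P) (hσ : 0 < σ) (i : Fin N) :
    HasLaw (fun ω => ε ω i / σ) (gaussianReal 0 1) P := by
  convert gaussianReal_div_const (h.law i) σ using 2
  · simp
  · ext
    simp [Real.coe_toNNReal _ (sq_nonneg _)]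
    field_simp

/-- Concentration of the empirical variance of the noise. -/
theorem exists_noise_variance_bernstein :
    ∃ C > (0 : ℝ), ∃ u₀ > (0 : ℝ), ∀ {Ω : Type*} [MeasurableSpace Ω] {P : Measure Ω}
      [IsProbabilityMeasure P] {N : ℕ} {σ : ℝ} {ε : Ω → Fin N → ℝ}, 0 < N → 0 < σ →
      IsGaussianNoise σ ε P → ∀ {u : ℝ}, 0 ≤ u → u ≤ u₀ →
        P.real {ω | u ≤ |1 / (N : ℝ) * ∑ i, (ε ω i / σ) ^ 2 - 1|}
          ≤ 2 * Real.exp (-(N * u ^ 2 / C)) := by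
  obtain ⟨C, hC, u₀, hu₀, hB⟩ := exists_bernstein_mul (c := 1) one_pos
  refine ⟨C, hC, u₀, hu₀, ?_⟩
  intro Ω _ P _ N σ ε hN hσ h u hu huu
  have hl := h.hasLaw_div hσ
  have hsub := fun i => hasSubgaussianMGF_of_hasLaw (hl i)
  have hm : ∀ i, ∫ ω, ε ω i / σ * (ε ω i / σ) ∂P = 1 := fun i => by
    have h1 := (hl i).variance_eq
    rw [variance_id_gaussianReal] at h1
    have h0 : ∫ ω, ε ω i / σ ∂P = 0 := by
      rw [(hl i).integral_eq]
      exact integral_id_gaussianReal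
    rw [variance_of_integral_eq_zero (hl i).aemeasurable h0] at h1
    simpa [sq] using h1
  have hind : iIndepFun (fun i ω => ε ω i / σ * (ε ω i / σ)) P :=
    h.indep.comp (fun _ y => y / σ * (y / σ)) (fun _ => by fun_prop)
  simp only [le_abs_average_sub_iff hN, sq]
  have h2 := hB hind hsub hsub hm hu huu
  rwa [sq] at h2

end Concentration

/-! ### The sub-Gaussian design -/

section Design

variable {Ω : Type*} [MeasurableSpace Ω] {P : Measure Ω} {N n : ℕ}
  {σ : ℝ} {S : Matrix (Fin n) (Fin n) ℝ} {X : Ω → Fin N → Fin n → ℝ}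

/-- The definition covers unit vectors only; other directions follow by scaling, with v = 0 treated
apart. -/
theorem IsSubGaussianVec.hasSubgaussianMGF [IsProbabilityMeasure P] {Y : Ω → Fin n → ℝ} (h : IsSubGaussianVec σ Y P)
    {v : Fin n → ℝ} {c : NNReal} (hv : σ ^ 2 * ∑ a, v a ^ 2 ≤ c) :
    HasSubgaussianMGF (fun ω => ∑ a, v a * Y ω a) c P := by
  set q := ∑ a, v a ^ 2 with hq
  have hq0 : 0 ≤ q := Finset.sum_nonneg fun _ _ => sq_nonneg _
  rcases hq0.eq_or_lt with h0 | h0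
  · have hz : ∀ a, v a = 0 := fun a => by
      have := (Finset.sum_eq_zero_iff_of_nonneg (fun i _ => sq_nonneg (v i))).1 h0.symm a
        (Finset.mem_univ _)
      exact pow_eq_zero_iff two_ne_zero |>.1 this
    simp only [hz, zero_mul, Finset.sum_const_zero]
    exact hasSubgaussianMGF_mono HasSubgaussianMGF.fun_zero zero_le
  · have hs : 0 < √q := Real.sqrt_pos.2 h0
    have hu : ∑ a, (v a / √q) ^ 2 = 1 := by
      simp only [div_pow, Real.sq_sqrt hq0, ← Finset.sum_div]
      exact div_self h0.ne'
    have h1 := ((h.2 _ hu).2.const_mul √q)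
    have h2 : (fun ω => √q * ∑ a, v a / √q * Y ω a) = fun ω => ∑ a, v a * Y ω a := by
      ext ω
      rw [Finset.mul_sum]
      exact Finset.sum_congr rfl fun a _ => by field_simp
    rw [h2] at h1
    refine hasSubgaussianMGF_mono h1 ?_
    have h3 : √q ^ 2 * Real.toNNReal (σ ^ 2) ≤ c := by
      rw [Real.sq_sqrt hq0, Real.coe_toNNReal _ (sq_nonneg _)]
      linarith
    exact h3

theorem IsSubGaussianVec.hasSubgaussianMGF_apply [IsProbabilityMeasure P] {Y : Ω → Fin n → ℝ}
    (h : IsSubGaussianVec σ Y P) {c : NNReal} (hc : σ ^ 2 ≤ c) (a : Fin n) :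
    HasSubgaussianMGF (fun ω => Y ω a) c P := by
  have := h.hasSubgaussianMGF (v := Pi.single a 1) (c := c) (by simp [Pi.single_apply, hc])
  simpa [Pi.single_apply] using this

namespace IsSubGaussianDesign

variable (h : IsSubGaussianDesign σ S X P)
include h

theorem symm (hN : 0 < N) (a b : Fin n) : S a b = S b a := by
  rw [← h.covariance ⟨0, hN⟩ a b, ← h.covariance ⟨0, hN⟩ b a, covariance_comm]

theorem memLp [IsProbabilityMeasure P] (i : Fin N) (a : Fin n) : MemLp (fun ω => X ω i a) 2 P :=
  ((h.subGaussian i).hasSubgaussianMGF_apply (c := Real.toNNReal (σ ^ 2))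
    (Real.le_coe_toNNReal _) a).memLp 2

theorem integral_mul [IsProbabilityMeasure P] (i : Fin N) (a b : Fin n) : ∫ ω, X ω i a * X ω i b ∂P = S a b := by
  rw [← h.covariance i a b, covariance_eq_sub (h.memLp i a) (h.memLp i b), (h.subGaussian i).1 a]
  simp

theorem integral_sum_mul [IsProbabilityMeasure P] (i : Fin N) (v : Fin n → ℝ) (b : Fin n) :
    ∫ ω, (∑ a, v a * X ω i a) * X ω i b ∂P = ∑ a, v a * S a b := by
  simp only [Finset.sum_mul, mul_assoc]
  have hint : ∀ a, Integrable (fun ω => v a * (X ω i a * X ω i b)) P := fun a =>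
    ((h.memLp i a).integrable_mul (h.memLp i b)).const_mul (v a)
  rw [integral_finsetSum _ fun a _ => hint a]
  exact Finset.sum_congr rfl fun a _ => by rw [integral_const_mul, h.integral_mul]

theorem iIndepFun_mul (u v : Fin n → ℝ) :
    iIndepFun (fun i ω => (∑ a, u a * X ω i a) * ∑ a, v a * X ω i a) P :=
  h.indep.comp (fun _ (y : Fin n → ℝ) => (∑ a, u a * y a) * ∑ a, v a * y a)
    (fun _ => by fun_prop)

end IsSubGaussianDesign

end Design

end GraphLasso

namespace GraphLasso

/-! ### The studentized statistic on a good event -/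

section Good

variable {N n : ℕ}

/-- For n ≥ 2, log n ≥ 1/4 and hence √(log n) ≤ 2 log n. The growth condition on s log n / √N thus
also controls s √(log n / N), the quantity in the restricted eigenvalue bound. -/
theorem sqrt_log_div_mul_le {s : ℝ} (hn : 2 ≤ n) (hs : 0 ≤ s) :
    √(Real.log n / N) * s ≤ 2 * (s * Real.log n / √(N : ℝ)) := by
  have hlog : 1 / 4 ≤ Real.log n := by
    have h1 : Real.log 2 ≤ Real.log n := Real.log_le_log two_pos (by exact_mod_cast hn)
    have := Real.log_two_gt_d9
    linarith
  have h2 : √(Real.log n) ≤ 2 * Real.log n := by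
    rw [Real.sqrt_le_left (by linarith)]
    nlinarith
  rw [Real.sqrt_div (by linarith)]
  calc √(Real.log n) / √(N : ℝ) * s ≤ 2 * Real.log n / √(N : ℝ) * s := by gcongr
    _ = _ := by ring

theorem sqrt_mul_log_div {N : ℕ} (hN : 0 < N) (L : ℝ) : √(N : ℝ) * (L / N) = L / √(N : ℝ) := by
  have h : √(N : ℝ) ≠ 0 := (Real.sqrt_pos.2 (Nat.cast_pos.2 hN)).ne'
  have hN' : (N : ℝ) ≠ 0 := (Nat.cast_pos.2 hN).ne'
  rw [eq_div_iff h, mul_comm, ← mul_assoc, Real.mul_self_sqrt (Nat.cast_nonneg N)]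
  field_simp

theorem abs_sqrt_sub_one_le {x : ℝ} (hx : 0 ≤ x) : |√x - 1| ≤ |x - 1| := by
  have h1 : x - 1 = (√x - 1) * (√x + 1) := by
    have := Real.mul_self_sqrt hx
    linear_combination -this
  have h2 : 1 ≤ |√x + 1| := by
    rw [abs_of_nonneg (by positivity)]
    linarith [Real.sqrt_nonneg x]
  rw [h1, abs_mul]
  exact le_mul_of_one_le_right (abs_nonneg _) h2

theorem abs_residualStd_div_sub_one_le {X : Matrix (Fin N) (Fin n) ℝ} {β b : Fin n → ℝ}
    {ε : Fin N → ℝ} {σ η p : ℝ} (hσ : 0 < σ)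
    (hη : |1 / (N : ℝ) * ∑ i, (ε i / σ) ^ 2 - 1| ≤ η)
    (hp : √(1 / (N : ℝ) * ∑ i, (X *ᵥ (b - β)) i ^ 2) ≤ p * σ) :
    |residualStd X (response X β ε) b / σ - 1| ≤ p + η := by
  have h1 := abs_residualStd_sub_le (X := X) β b ε
  have h2 : √(1 / (N : ℝ) * ∑ i, ε i ^ 2) / σ = √(1 / (N : ℝ) * ∑ i, (ε i / σ) ^ 2) := by
    rw [← Real.sqrt_sq hσ.le, ← Real.sqrt_div' _ (sq_nonneg σ), Real.sqrt_sq hσ.le]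
    congr 1
    simp only [div_pow, ← Finset.sum_div]
    ring
  have h3 : |√(1 / (N : ℝ) * ∑ i, (ε i / σ) ^ 2) - 1| ≤ η :=
    (abs_sqrt_sub_one_le (mul_nonneg (by positivity)
      (Finset.sum_nonneg fun _ _ => sq_nonneg _))).trans hη
  have h4 : |residualStd X (response X β ε) b / σ - √(1 / (N : ℝ) * ∑ i, (ε i / σ) ^ 2)| ≤ p := by
    rw [← h2, ← sub_div, abs_div, abs_of_pos hσ, div_le_iff₀ hσ]
    exact h1.trans hp
  calc |residualStd X (response X β ε) b / σ - 1|
      ≤ |residualStd X (response X β ε) b / σ - √(1 / (N : ℝ) * ∑ i, (ε i / σ) ^ 2)|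
        + |√(1 / (N : ℝ) * ∑ i, (ε i / σ) ^ 2) - 1| := abs_sub_le _ _ _
    _ ≤ p + η := by linarith

/-- The score is bounded in terms of the normalized scores. -/
theorem abs_score_le {X : Matrix (Fin N) (Fin n) ℝ} {ε : Fin N → ℝ} {σ B x : ℝ} (hN : 0 < N)
    (hσ : 0 < σ) {a : Fin n} (hB : sampleCov X a a ≤ B)
    (h : |∑ i, unitWeight (fun i => X i a) i * (ε i / σ)| ≤ x * √(Real.log n)) :
    |1 / (N : ℝ) * ∑ i, X i a * ε i| ≤ √B * x * √(Real.log n / N) * σ := by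
  have hN' : (0 : ℝ) < N := Nat.cast_pos.2 hN
  have h1 : √(∑ i, X i a ^ 2) = √(N : ℝ) * √(sampleCov X a a) := by
    rw [sampleCov_apply, ← Real.sqrt_mul hN'.le]
    congr 1
    simp only [sq]
    field_simp
  have hlog : 0 ≤ Real.log n := Real.log_natCast_nonneg n
  rw [sum_mul_eq_sqrt_mul_sum_unitWeight (fun i => X i a) ε hσ, h1, abs_mul, abs_mul,
    abs_of_nonneg (by positivity), abs_of_nonneg (by positivity)]
  have h2 : √(sampleCov X a a) ≤ √B := Real.sqrt_le_sqrt hB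
  calc 1 / (N : ℝ) * (√(N : ℝ) * √(sampleCov X a a) * σ
        * |∑ i, unitWeight (fun i => X i a) i * (ε i / σ)|)
      ≤ 1 / (N : ℝ) * (√(N : ℝ) * √B * σ * (x * √(Real.log n))) := by gcongr
    _ = √B * x * (√(N : ℝ) * (√(Real.log n) / N)) * σ := by ring
    _ = _ := by rw [sqrt_mul_log_div hN, Real.sqrt_div hlog]

/-- If the sample covariance is entrywise close to `S`, and the dimension is not too large, then
the CLIME program is feasible. -/
theorem exists_climeFeasible_of_dim_le {X : Matrix (Fin N) (Fin n) ℝ}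
    {S : Matrix (Fin n) (Fin n) ℝ} {c D mu : ℝ}
    (hS : ∀ v : Fin n → ℝ, c * ∑ a, v a ^ 2 ≤ v ⬝ᵥ (S *ᵥ v))
    (hD : ∀ a b, |sampleCov X a b - S a b| ≤ D) (hD0 : 0 ≤ D) (hDn : D * n < c) (hmu : 0 ≤ mu) :
    ∃ Θ, ClimeFeasible X mu Θ := by
  have hu : IsUnit (sampleCov X).det := by
    refine isUnit_det_of_quadratic (c := c - D * n) (by linarith) fun v => ?_
    have h1 := le_quadratic_sampleCov hS hD v
    have h2 := l1_le_sqrt_card_mul v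
    have hq : 0 ≤ ∑ a, v a ^ 2 := Finset.sum_nonneg fun _ _ => sq_nonneg _
    have h3 : l1 v ^ 2 ≤ n * ∑ a, v a ^ 2 := by
      calc l1 v ^ 2 ≤ (√(Fintype.card (Fin n)) * √(∑ i, v i ^ 2)) ^ 2 :=
            pow_le_pow_left₀ (l1_nonneg v) h2 2
        _ = _ := by
            rw [mul_pow, Real.sq_sqrt (by positivity), Real.sq_sqrt hq, Fintype.card_fin]
    have h4 : D * l1 v ^ 2 ≤ D * (n * ∑ a, v a ^ 2) := by gcongr
    linarith
  -- The exact inverse has zero error, so any nonnegative tolerance is met.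
  refine ⟨(sampleCov X)⁻¹, fun a b => ?_⟩
  rw [nonsing_inv_mul _ hu, sub_self]
  simpa using hmu

/-- On a good event the studentized statistic is close to its leading term. -/
theorem abs_studentized_sub_leadingTerm_le_of_good {G : SimpleGraph (Fin n)} {k : ℕ}
    {ν s₁ s₂ s lamg lam mu c c' σ τ τ' CLam CMu A B η κ : ℝ} {X : Matrix (Fin N) (Fin n) ℝ}
    {S Θ : Matrix (Fin n) (Fin n) ℝ} {β b : Fin n → ℝ} {ε : Fin N → ℝ} {j : Fin n}
    (hN : 0 < N) (hn : 2 ≤ n) (hc : 0 < c) (hc' : 0 < c') (hσ : 0 < σ)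
    (hν : 0 ≤ ν) (hs₁ : 0 < s₁) (hs₂ : 0 < s₂) (hνs : ν ≤ s₂ / s₁) (hβ : β ∈ paramSpace G k s₁ s₂)
    (hlam : 0 < lam) (hlamC : lam ≤ CLam * (σ * √(Real.log n / N)))
    (hlamg : lamg = lam * √(ν / (2 * maxDeg G) ^ (k + 1)))
    (hmu : mu ≤ CMu * √(Real.log n / N)) (hmu2 : mu ≤ 1 / 2)
    (hb : IsGraphLasso G k lamg lam X (response X β ε) b) (hΘ : ClimeFeasible X mu Θ)
    (hS : ∀ v : Fin n → ℝ, c * ∑ a, v a ^ 2 ≤ v ⬝ᵥ (S *ᵥ v))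
    (hτ0 : 0 ≤ τ) (hD : ∀ a b, |sampleCov X a b - S a b| ≤ τ * √(Real.log n / N))
    (hjj : sampleCov X j j ≤ 2 * c') (hτ'0 : 0 ≤ τ')
    (hτ' : ∀ a, |1 / (N : ℝ) * ∑ i, X i a * ε i| ≤ τ' * √(Real.log n / N) * σ)
    (hs : s₂ ≤ s) (hcase : 2 * (τ' * √(Real.log n / N) * σ) ≤ lam ∨ n ≤ s)
    (hA : 6 * τ' + 3 * CLam ≤ A) (hκ : s * Real.log n / √(N : ℝ) = κ) (hκτ : 72 * τ * κ ≤ c / 2)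
    (hη : |1 / (N : ℝ) * ∑ i, (ε i / σ) ^ 2 - 1| ≤ η)
    (hsmall : A * √(8 * κ / c) + η ≤ 1 / 2) (hZ : |leadingTerm X Θ j σ ε| ≤ B) :
    |studentized X (response X β ε) Θ b β j - leadingTerm X Θ j σ ε|
      ≤ 2 * (B * (A * √(8 * κ / c) + η) + 24 * CMu * A * κ / (c * √(1 / (8 * c')))) := by
  have hN1 : (1 : ℝ) ≤ N := by exact_mod_cast hN
  have hlog : 0 < Real.log n := Real.log_pos (by exact_mod_cast hn)
  have hs0 : 0 < s := hs₂.trans_le hs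
  have hrs := sqrt_log_div_mul_le (N := N) hn hs0.le
  rw [hκ] at hrs
  have hr0 : 0 < √(Real.log n / N) := Real.sqrt_pos.2 (by positivity)
  have hrr : √(Real.log n / N) ^ 2 = Real.log n / N := Real.sq_sqrt (by positivity)
  set r := √(Real.log n / N) with hr
  have hκ0 : 0 ≤ κ := by rw [← hκ]; positivity
  -- One factor r comes from μ and one from the ℓ₁ rate r s, so the scaled bias is of order κ.
  have hNrs : √(N : ℝ) * (r ^ 2 * s) = κ := by
    rw [hrr, ← mul_assoc, sqrt_mul_log_div hN, ← hκ]; ring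
  have hrs2 : r ^ 2 * s ≤ κ := by
    rw [← hNrs]
    refine le_mul_of_one_le_left (by positivity) ?_
    rw [← Real.sqrt_one]
    exact Real.sqrt_le_sqrt hN1
  have hDs : 36 * (τ * r) * s ≤ c / 2 := by
    calc 36 * (τ * r) * s = 36 * τ * (r * s) := by ring
      _ ≤ 36 * τ * (2 * κ) := by gcongr
      _ ≤ c / 2 := by linarith
  obtain ⟨hl1, hpred⟩ := lasso_error_bound hν hs₁ hνs hs hlam hlamg hβ hb hc hs₂ hS hD hDs
    (by positivity) hτ' (by positivity) hcase
  have hAσ : 6 * (τ' * r * σ) + 3 * lam ≤ A * (σ * r) := by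
    calc 6 * (τ' * r * σ) + 3 * lam ≤ (6 * τ' + 3 * CLam) * (σ * r) := by linarith
      _ ≤ _ := by gcongr
  have hA0' : 0 < 6 * (τ' * r * σ) + 3 * lam := by positivity
  have hA0 : 0 < A := pos_of_mul_pos_left (hA0'.trans_le hAσ) (by positivity)
  have hmu0 : 0 ≤ mu := (abs_nonneg _).trans (hΘ j j)
  have hCMu0 : 0 ≤ CMu := nonneg_of_mul_nonneg_left (hmu0.trans hmu) hr0
  have hω : 0 < 1 / (8 * c') := by positivity
  have hsω : 0 < √(1 / (8 * c')) := Real.sqrt_pos.2 hω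
  have hvar : 1 / (8 * c') ≤ (Θ * sampleCov X * Θᵀ) j j := by
    have h := hΘ.variance_lower_bound hmu2 hjj (by positivity)
    convert h using 2
    ring
  have hpb : √(1 / (N : ℝ) * ∑ i, (X *ᵥ (b - β)) i ^ 2) ≤ A * √(8 * κ / c) * σ := by
    rw [Real.sqrt_le_left (by positivity), mul_pow, mul_pow, Real.sq_sqrt (by positivity)]
    calc _ ≤ 8 / c * (6 * (τ' * r * σ) + 3 * lam) ^ 2 * s := hpred
      _ ≤ 8 / c * (A * (σ * r)) ^ 2 * s := by gcongr
      _ = 8 / c * A ^ 2 * σ ^ 2 * (r ^ 2 * s) := by ring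
      _ ≤ 8 / c * A ^ 2 * σ ^ 2 * κ := by gcongr
      _ = _ := by ring
  refine abs_studentized_sub_leadingTerm_le hN hσ hω hΘ hvar hZ
    (abs_residualStd_div_sub_one_le hσ hη hpb) hsmall ?_
  calc √(N : ℝ) * (mu * l1 (b - β))
      ≤ √(N : ℝ) * (CMu * r * (24 / c * (6 * (τ' * r * σ) + 3 * lam) * s)) := by
        gcongr
        exact l1_nonneg _
    _ ≤ √(N : ℝ) * (CMu * r * (24 / c * (A * (σ * r)) * s)) := by gcongr
    _ = 24 * CMu * A / c * σ * (√(N : ℝ) * (r ^ 2 * s)) := by ring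
    _ = _ := by rw [hNrs]; field_simp

end Good

/-! ### Probabilities of the good events -/

section Events

/-- The sample covariance is entrywise close to the covariance matrix. -/
theorem exists_sampleCov_bound (σx : ℝ) :
    ∃ C > (0 : ℝ), ∃ u₀ > (0 : ℝ), ∀ {Ω : Type*} [MeasurableSpace Ω] {P : Measure Ω}
      [IsProbabilityMeasure P] {N n : ℕ} {S : Matrix (Fin n) (Fin n) ℝ}
      {X : Ω → Fin N → Fin n → ℝ}, 0 < N → 0 < n → IsSubGaussianDesign σx S X P →
      ∀ {τ q : ℝ}, 0 ≤ τ → (2 + q) * C ≤ τ ^ 2 → τ * √(Real.log n / N) ≤ u₀ →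
        P.real {ω | ∃ a b, τ * √(Real.log n / N) ≤ |sampleCov (Matrix.of (X ω)) a b - S a b|}
          ≤ 2 * Real.exp (-(q * Real.log n)) := by
  have hc0 : 0 < Real.toNNReal (σx ^ 2 + 1) := Real.toNNReal_pos.2 (by positivity)
  have hc1 : σx ^ 2 ≤ Real.toNNReal (σx ^ 2 + 1) := by
    rw [Real.coe_toNNReal _ (by positivity)]; linarith
  obtain ⟨C, hC, u₀, hu₀, hB⟩ := exists_uniform_bernstein hc0
  refine ⟨C, hC, u₀, hu₀, ?_⟩
  intro Ω _ P _ N n S X hN hn h τ q hτ hq hτu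
  have hind : ∀ a b, iIndepFun (fun i ω => X ω i a * X ω i b) P := fun a b => by
    have h0 := h.iIndepFun_mul (Pi.single a 1) (Pi.single b 1)
    simpa [Pi.single_apply] using h0
  have h1 := hB (U := fun a i ω => X ω i a) (V := fun a i ω => X ω i a) (m := fun a b => S a b)
    hN hn hind
    (fun a i => (h.subGaussian i).hasSubgaussianMGF_apply hc1 a)
    (fun a i => (h.subGaussian i).hasSubgaussianMGF_apply hc1 a)
    (fun a b i => h.integral_mul i a b) hτ hq hτu
  simpa only [sampleCov_apply, of_apply] using h1

/-- The inverse covariance matrix is feasible for the CLIME program. -/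
theorem exists_clime_bound (σx : ℝ) {cmin : ℝ} (hcmin : 0 < cmin) :
    ∃ C > (0 : ℝ), ∃ u₀ > (0 : ℝ), ∀ {Ω : Type*} [MeasurableSpace Ω] {P : Measure Ω}
      [IsProbabilityMeasure P] {N n : ℕ} {S : Matrix (Fin n) (Fin n) ℝ}
      {X : Ω → Fin N → Fin n → ℝ} {cmax : ℝ}, 0 < N → 0 < n → IsSubGaussianDesign σx S X P →
      spectrum ℝ S ⊆ Set.Icc cmin cmax →
      ∀ {τ q : ℝ}, 0 ≤ τ → (2 + q) * C ≤ τ ^ 2 → τ * √(Real.log n / N) ≤ u₀ →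
        P.real {ω | ∃ a b, τ * √(Real.log n / N) ≤ |(S⁻¹ * sampleCov (Matrix.of (X ω)) - 1) a b|}
          ≤ 2 * Real.exp (-(q * Real.log n)) := by
  -- A single variance proxy for both the coordinates of X_i and the combinations S⁻¹_a X_i; the
  -- summand 1 only ensures positivity.
  have hpos : 0 < σx ^ 2 + σx ^ 2 * (1 / cmin ^ 2) + 1 := by positivity
  have hc0 : 0 < Real.toNNReal (σx ^ 2 + σx ^ 2 * (1 / cmin ^ 2) + 1) := Real.toNNReal_pos.2 hpos
  have hp : 0 ≤ σx ^ 2 * (1 / cmin ^ 2) := by positivity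
  have hc1 : σx ^ 2 ≤ Real.toNNReal (σx ^ 2 + σx ^ 2 * (1 / cmin ^ 2) + 1) := by
    rw [Real.coe_toNNReal _ hpos.le]; linarith
  have hc2 : σx ^ 2 * (1 / cmin ^ 2)
      ≤ Real.toNNReal (σx ^ 2 + σx ^ 2 * (1 / cmin ^ 2) + 1) := by
    rw [Real.coe_toNNReal _ hpos.le]; linarith [sq_nonneg σx]
  obtain ⟨C, hC, u₀, hu₀, hB⟩ := exists_uniform_bernstein hc0
  refine ⟨C, hC, u₀, hu₀, ?_⟩
  intro Ω _ P _ N n S X cmax hN hn h hspec τ q hτ hq hτu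
  have hsymm := h.symm hN
  have hu := isUnit_det_of_quadratic hcmin (le_quadratic_of_spectrum hsymm hspec)
  have hind : ∀ a b, iIndepFun (fun i ω => (∑ c, S⁻¹ a c * X ω i c) * X ω i b) P := fun a b => by
    have h0 := h.iIndepFun_mul (fun c => S⁻¹ a c) (Pi.single b 1)
    simpa [Pi.single_apply] using h0
  have h1 := hB (U := fun a i ω => ∑ c, S⁻¹ a c * X ω i c) (V := fun a i ω => X ω i a)
    (m := fun a b => (1 : Matrix (Fin n) (Fin n) ℝ) a b)
    hN hn hind
    (fun a i => (h.subGaussian i).hasSubgaussianMGF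
      ((mul_le_mul_of_nonneg_left (sum_sq_inv_row_le hcmin hsymm hspec a) (sq_nonneg σx)).trans hc2))
    (fun a i => (h.subGaussian i).hasSubgaussianMGF_apply hc1 a)
    (fun a b i => by rw [h.integral_sum_mul, ← nonsing_inv_mul S hu, mul_apply]) hτ hq hτu
  have h2 : ∀ ω i a, (Matrix.of (X ω) * S⁻¹ᵀ) i a = ∑ c, S⁻¹ a c * X ω i c := fun ω i a => by
    rw [mul_apply]
    exact Finset.sum_congr rfl fun c _ => mul_comm _ _
  simpa only [Matrix.sub_apply, mul_sampleCov_apply, h2, of_apply] using h1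

variable {Ω : Type*} [MeasurableSpace Ω] {P : Measure Ω} [IsProbabilityMeasure P] {N n : ℕ}
  {σ : ℝ} {X : Ω → Fin N → Fin n → ℝ} {ε : Ω → Fin N → ℝ}

theorem measureReal_normalized_score_le (hN : 0 < N) (hn : 0 < n) (hσ : 0 < σ) (hX : Measurable X)
    (hε : IsGaussianNoise σ ε P) (hind : IndepFun X ε P) {x q : ℝ} (hx : 0 ≤ x)
    (hq : 1 + q ≤ x ^ 2 / 2) :
    P.real {ω | ∃ a, x * √(Real.log n)
        ≤ |∑ i, unitWeight (fun i => Matrix.of (X ω) i a) i * (ε ω i / σ)|}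
      ≤ 2 * Real.exp (-(q * Real.log n)) :=
  hε.measureReal_exists_ge_le hσ hX hind
    (w := fun a (x : Fin N → Fin n → ℝ) i => unitWeight (fun i => x i a) i)
    (fun a i => (measurable_unitWeight i).comp (by fun_prop))
    (fun a x => sum_unitWeight_sq hN _) hn hx hq

theorem hasLaw_leadingTerm (hN : 0 < N) (hσ : 0 < σ) (hX : Measurable X)
    (hε : IsGaussianNoise σ ε P) (hind : IndepFun X ε P)
    {Θ : (Fin N → Fin n → ℝ) → Matrix (Fin n) (Fin n) ℝ}
    (hΘ : ∀ a b, Measurable fun x => Θ x a b) (j : Fin n) :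
    HasLaw (fun ω => leadingTerm (Matrix.of (X ω)) (Θ (X ω)) j σ (ε ω)) (gaussianReal 0 1) P := by
  refine hε.hasLaw_sum_random hσ hX hind
    (w := fun x i => unitWeight (fun i => (Matrix.of x * (Θ x)ᵀ) i j) i)
    (fun i => (measurable_unitWeight i).comp (measurable_pi_iff.2 fun i => ?_))
    (fun x => sum_unitWeight_sq hN _)
  have : ∀ x, (Matrix.of x * (Θ x)ᵀ) i j = ∑ c, x i c * Θ x j c := fun x => rfl
  simp only [this]
  fun_prop

end Events

end GraphLasso

namespace GraphLasso

/-! ### Union bound over the exceptional events. -/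

section Events

variable {Ω : Type*} [MeasurableSpace Ω] {P : Measure Ω} [IsProbabilityMeasure P] {N n : ℕ}
  {σ : ℝ} {X : Ω → Fin N → Fin n → ℝ} {ε : Ω → Fin N → ℝ}

/-- Union bound for the event that the studentized statistic is far from its leading term. -/
theorem measureReal_studentized_sub_leadingTerm_le {G : SimpleGraph (Fin n)} {k : ℕ}
    {ν s₁ s₂ s lamg lam mu c c' τ x CLam CMu A B η κ e δ : ℝ}
    {S : Matrix (Fin n) (Fin n) ℝ} {β : Fin n → ℝ} {b : Ω → Fin n → ℝ}
    {Θ : (Fin N → Fin n → ℝ) → Matrix (Fin n) (Fin n) ℝ} {j : Fin n}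
    (hN : 0 < N) (hn : 2 ≤ n) (hc : 0 < c) (hc' : 0 < c') (hσ : 0 < σ)
    (hν : 0 ≤ ν) (hs₁ : 0 < s₁) (hs₂ : 0 < s₂) (hνs : ν ≤ s₂ / s₁) (hβ : β ∈ paramSpace G k s₁ s₂)
    (hlam : 0 < lam) (hlamC : lam ≤ CLam * (σ * √(Real.log n / N)))
    (hlamg : lamg = lam * √(ν / (2 * maxDeg G) ^ (k + 1)))
    (hmu : mu ≤ CMu * √(Real.log n / N)) (hmu2 : mu ≤ 1 / 2)
    (hb : ∀ᵐ ω ∂P, IsGraphLasso G k lamg lam (Matrix.of (X ω))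
      (response (Matrix.of (X ω)) β (ε ω)) (b ω))
    (hΘ : ∀ᵐ ω ∂P, (∃ Θ', ClimeFeasible (Matrix.of (X ω)) mu Θ') →
      IsClime (Matrix.of (X ω)) mu (Θ (X ω)))
    (hsymm : ∀ a a', S a a' = S a' a) (hspec : spectrum ℝ S ⊆ Set.Icc c c') (hτ0 : 0 ≤ τ)
    (hτc : τ * √(Real.log n / N) ≤ c') (hx : 0 ≤ x) (hs : s₂ ≤ s)
    (hcase : 2 * (√(2 * c') * x * √(Real.log n / N) * σ) ≤ lam ∨ n ≤ s)
    (hA : 6 * (√(2 * c') * x) + 3 * CLam ≤ A) (hκ : s * Real.log n / √(N : ℝ) = κ)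
    (hκτ : 72 * τ * κ ≤ c / 2) (hsmall : A * √(8 * κ / c) + η ≤ 1 / 2)
    (he : 2 * (B * (A * √(8 * κ / c) + η) + 24 * CMu * A * κ / (c * √(1 / (8 * c')))) ≤ e)
    (hcov : P.real {ω | ∃ a a', τ * √(Real.log n / N)
      ≤ |sampleCov (Matrix.of (X ω)) a a' - S a a'|} ≤ δ)
    (hscore : P.real {ω | ∃ a, x * √(Real.log n)
      ≤ |∑ i, unitWeight (fun i => Matrix.of (X ω) i a) i * (ε ω i / σ)|} ≤ δ)
    (hfeas : P.real {ω | (∀ a a', |sampleCov (Matrix.of (X ω)) a a' - S a a'|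
      ≤ τ * √(Real.log n / N)) ∧ ¬ ∃ Θ', ClimeFeasible (Matrix.of (X ω)) mu Θ'} ≤ δ)
    (hvar : P.real {ω | η ≤ |1 / (N : ℝ) * ∑ i, (ε ω i / σ) ^ 2 - 1|} ≤ δ)
    (hlead : P.real {ω | B ≤ |leadingTerm (Matrix.of (X ω)) (Θ (X ω)) j σ (ε ω)|} ≤ δ) :
    P.real {ω | e < |studentized (Matrix.of (X ω)) (response (Matrix.of (X ω)) β (ε ω))
      (Θ (X ω)) (b ω) β j - leadingTerm (Matrix.of (X ω)) (Θ (X ω)) j σ (ε ω)|} ≤ 5 * δ := by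
  set E₁ := {ω | ∃ a a', τ * √(Real.log n / N) ≤ |sampleCov (Matrix.of (X ω)) a a' - S a a'|}
  set E₂ := {ω | ∃ a, x * √(Real.log n)
      ≤ |∑ i, unitWeight (fun i => Matrix.of (X ω) i a) i * (ε ω i / σ)|}
  -- Infeasibility is counted only where the covariance bound holds: in small dimensions that bound
  -- itself implies feasibility, and this event is empty.
  set E₃ := {ω | (∀ a a', |sampleCov (Matrix.of (X ω)) a a' - S a a'|
      ≤ τ * √(Real.log n / N)) ∧ ¬ ∃ Θ', ClimeFeasible (Matrix.of (X ω)) mu Θ'}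
  set E₄ := {ω | η ≤ |1 / (N : ℝ) * ∑ i, (ε ω i / σ) ^ 2 - 1|}
  set E₅ := {ω | B ≤ |leadingTerm (Matrix.of (X ω)) (Θ (X ω)) j σ (ε ω)|}
  have hsub : {ω | e < |studentized (Matrix.of (X ω)) (response (Matrix.of (X ω)) β (ε ω))
      (Θ (X ω)) (b ω) β j - leadingTerm (Matrix.of (X ω)) (Θ (X ω)) j σ (ε ω)|}
      ≤ᵐ[P] (E₁ ∪ (E₂ ∪ (E₃ ∪ (E₄ ∪ E₅))) : Set Ω) := by
    filter_upwards [hb, hΘ] with ω hbω hΘω hω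
    by_contra hnot
    have hnot' : ω ∉ E₁ ∪ (E₂ ∪ (E₃ ∪ (E₄ ∪ E₅))) := hnot
    simp only [Set.mem_union, not_or] at hnot'
    obtain ⟨h1, h2, h3, h4, h5⟩ := hnot'
    have h1' : ∀ a a', |sampleCov (Matrix.of (X ω)) a a' - S a a'| ≤ τ * √(Real.log n / N) :=
      fun a a' => le_of_not_ge fun h => h1 ⟨a, a', h⟩
    have h2' : ∀ a, |∑ i, unitWeight (fun i => Matrix.of (X ω) i a) i * (ε ω i / σ)|
        ≤ x * √(Real.log n) := fun a => le_of_not_ge fun h => h2 ⟨a, h⟩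
    have h3' : ∃ Θ', ClimeFeasible (Matrix.of (X ω)) mu Θ' := by
      by_contra h
      exact h3 ⟨h1', h⟩
    have hdiag : ∀ a, sampleCov (Matrix.of (X ω)) a a ≤ 2 * c' := fun a => by
      have := (abs_le.1 (h1' a a)).2
      have := apply_self_le_of_spectrum hsymm hspec a
      linarith
    have hfin := abs_studentized_sub_leadingTerm_le_of_good hN hn hc hc' hσ hν hs₁ hs₂ hνs hβ hlam
      hlamC hlamg hmu hmu2 hbω (hΘω h3').1 (le_quadratic_of_spectrum hsymm hspec) hτ0 h1' (hdiag j)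
      (by positivity) (fun a => abs_score_le hN hσ (hdiag a) (h2' a)) hs hcase hA hκ hκτ
      (le_of_not_ge h4) hsmall (le_of_not_ge h5)
    exact absurd (hfin.trans he) (not_le.2 hω)
  -- Only monotonicity up to null sets and subadditivity are used, so these events need not be shown
  -- measurable.
  have h0 : P.real {ω | e < |studentized (Matrix.of (X ω)) (response (Matrix.of (X ω)) β (ε ω))
      (Θ (X ω)) (b ω) β j - leadingTerm (Matrix.of (X ω)) (Θ (X ω)) j σ (ε ω)|}
      ≤ P.real (E₁ ∪ (E₂ ∪ (E₃ ∪ (E₄ ∪ E₅)))) :=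
    ENNReal.toReal_mono (measure_ne_top _ _) (measure_mono_ae hsub)
  have u1 := measureReal_union_le (μ := P) E₁ (E₂ ∪ (E₃ ∪ (E₄ ∪ E₅)))
  have u2 := measureReal_union_le (μ := P) E₂ (E₃ ∪ (E₄ ∪ E₅))
  have u3 := measureReal_union_le (μ := P) E₃ (E₄ ∪ E₅)
  have u4 := measureReal_union_le (μ := P) E₄ E₅
  linarith

end Events

/-- With c = log 2 this gives one exponent q for which 2 n^(-q) ≤ δ simultaneously for all n ≥ 2. -/
theorem exists_two_mul_exp_neg_le {c δ : ℝ} (hc : 0 < c) (hδ : 0 < δ) :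
    ∃ q, 0 ≤ q ∧ ∀ y, q * c ≤ y → 2 * Real.exp (-y) ≤ δ := by
  refine ⟨max 0 (Real.log (2 / δ) / c), le_max_left _ _, fun y hy => ?_⟩
  have h1 : Real.log (2 / δ) ≤ y := by
    calc Real.log (2 / δ) = Real.log (2 / δ) / c * c := by field_simp
      _ ≤ max 0 (Real.log (2 / δ) / c) * c := by gcongr; exact le_max_right _ _
      _ ≤ y := hy
  calc 2 * Real.exp (-y) ≤ 2 * Real.exp (-Real.log (2 / δ)) := by gcongr
    _ = δ := by
        rw [Real.exp_neg, Real.exp_log (by positivity)]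
        field_simp

end GraphLasso

/-! ### Choice of the constants and passage to the limit. -/

theorem corollary3 (σx cmin cmax : ℝ) (hσx : 0 < σx) (hcmin : 0 < cmin) (hcmax : 0 < cmax) :
    -- thresholds for the constants in the tuning parameters
    ∃ cLam > (0 : ℝ), ∃ cMu > (0 : ℝ), ∀ (CLam CMu : ℝ)
      -- fixed order `k` and constant `ν`
      (k : ℕ) (ν : ℝ) (_ : 0 ≤ ν) (_ : ν < 1)
      -- a sequence of problems: sample sizes, dimensions, graphs, sparsity levels
      (N n : ℕ → ℕ) (_ : Tendsto N atTop atTop) (_ : ∀ t, 2 ≤ n t)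
      (G : ∀ t, SimpleGraph (Fin (n t)))
      (s₁ s₂ M : ℕ → ℝ) (_ : ∀ t, 0 < s₁ t) (_ : ∀ t, 0 < s₂ t) (_ : ∀ t, ν ≤ s₂ t / s₁ t)
      (β : ∀ t, Fin (n t) → ℝ) (_ : ∀ t, β t ∈ paramSpace (G t) k (s₁ t) (s₂ t))
      -- the random design and the Gaussian noise
      (Ω : ℕ → Type*) [∀ t, MeasurableSpace (Ω t)] (P : ∀ t, Measure (Ω t))
      [∀ t, IsProbabilityMeasure (P t)]
      (X : ∀ t, Ω t → Fin (N t) → Fin (n t) → ℝ) (ε : ∀ t, Ω t → Fin (N t) → ℝ)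
      (Sx : ∀ t, Matrix (Fin (n t)) (Fin (n t)) ℝ) (σε : ℕ → ℝ) (_ : ∀ t, 0 < σε t)
      (_ : ∀ t, IsSubGaussianDesign σx (Sx t) (X t) (P t))
      (_ : ∀ t, spectrum ℝ (Sx t) ⊆ Set.Icc cmin cmax)
      (_ : ∀ t a, ∑ b, |(Sx t)⁻¹ a b| ≤ M t)
      (_ : ∀ t, IsGaussianNoise (σε t) (ε t) (P t))
      (_ : ∀ t, IndepFun (X t) (ε t) (P t))
      -- the tuning parameters
      (lam lamg mu : ℕ → ℝ)
      (_ : ∀ t, cLam * (σε t * √(Real.log (n t) / N t)) ≤ lam t)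
      (_ : ∀ t, lam t ≤ CLam * (σε t * √(Real.log (n t) / N t)))
      (_ : ∀ t, lamg t = lam t * √(ν / (2 * maxDeg (G t)) ^ (k + 1)))
      (_ : ∀ t, cMu * √(Real.log (n t) / N t) ≤ mu t)
      (_ : ∀ t, mu t ≤ CMu * √(Real.log (n t) / N t))
      -- the Graph-Piecewise-Polynomial-Lasso
      (βhat : ∀ t, Ω t → Fin (n t) → ℝ) (_ : ∀ t, AEMeasurable (βhat t) (P t))
      (_ : ∀ t, ∀ᵐ ω ∂(P t), IsGraphLasso (G t) k (lamg t) (lam t) (Matrix.of (X t ω))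
        (response (Matrix.of (X t ω)) (β t) (ε t ω)) (βhat t ω))
      -- the CLIME estimator, a measurable function of the design matrix
      (Θhat : ∀ t, (Fin (N t) → Fin (n t) → ℝ) → Matrix (Fin (n t)) (Fin (n t)) ℝ)
      (_ : ∀ t a b, Measurable fun x => Θhat t x a b)
      (_ : ∀ t, ∀ᵐ ω ∂(P t), (∃ Θ, ClimeFeasible (Matrix.of (X t ω)) (mu t) Θ) →
        IsClime (Matrix.of (X t ω)) (mu t) (Θhat t (X t ω)))
      -- the growth conditions
      (_ : Tendsto (fun t => s₂ t * Real.log (n t) / √(N t : ℝ)) atTop (𝓝 0))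
      (_ : Tendsto (fun t => M t * √(Real.log (n t) / N t)) atTop (𝓝 0))
      -- the coordinate
      (j : ∀ t, Fin (n t)),
      TendstoInDistribution
        (fun t ω => studentized (Matrix.of (X t ω))
          (response (Matrix.of (X t ω)) (β t) (ε t ω)) (Θhat t (X t ω)) (βhat t ω) (β t) (j t))
        atTop (id : ℝ → ℝ) P (gaussianReal 0 1) := by
  obtain ⟨C₁, hC₁, u₁, hu₁, hcovB⟩ := exists_sampleCov_bound σx
  obtain ⟨C₂, hC₂, u₂, hu₂, hclimeB⟩ := exists_clime_bound σx hcmin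
  obtain ⟨C₃, hC₃, u₃, hu₃, hvarB⟩ := exists_noise_variance_bernstein
  have hcs : 0 < √(2 * cmax) := Real.sqrt_pos.2 (by positivity)
  -- Both thresholds correspond to q = 1, that is, to failure probability 2/n. The score threshold x
  -- = 2 satisfies 1 + q ≤ x²/2, and √(2 cmax) x bounds the score in units of σ_ε √(log n / N); the
  -- outer 2 gives 2τ ≤ λ. For CLIME, 3 = 2 + q.
  refine ⟨2 * (√(2 * cmax) * 2), by positivity, √(3 * C₂), Real.sqrt_pos.2 (by positivity), ?_⟩
  intro CLam CMu k ν hν _ N n hN hn G s₁ s₂ M hs₁ hs₂ hνs β hβ Ω _ P _ X ε Sx σε hσε hX hspec hM hε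
    hXε lam lamg mu hlam hlamC hlamg hmu hmuC βhat hβhat hlasso Θhat hΘm hΘ hgrowth hMr j
  have hNpos : ∀ᶠ t in atTop, 0 < N t := hN.eventually_gt_atTop 0
  have hn0 : ∀ t, 0 < n t := fun t => two_pos.trans_le (hn t)
  have hlog2 : 0 < Real.log 2 := Real.log_pos one_lt_two
  have hlogn : ∀ t, Real.log 2 ≤ Real.log (n t) := fun t =>
    Real.log_le_log two_pos (by exact_mod_cast hn t)
  have hNinf : Tendsto (fun t => (N t : ℝ)) atTop atTop := tendsto_natCast_atTop_atTop.comp hN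
  -- This follows from the condition on M because M ≥ 1 / cmax. The sparsity condition alone would
  -- not do, as s₂ may tend to zero.
  have hr : Tendsto (fun t => √(Real.log (n t) / N t)) atTop (𝓝 0) := by
    have h0 := hMr.const_mul cmax
    rw [mul_zero] at h0
    refine squeeze_zero' (Eventually.of_forall fun t => Real.sqrt_nonneg _) ?_ h0
    filter_upwards [hNpos] with t ht
    have h1 := le_inv_apply_self hcmin hcmax ((hX t).symm ht) (hspec t) (j t)
    have h2 : (Sx t)⁻¹ (j t) (j t) ≤ M t := (le_abs_self _).trans
      ((Finset.single_le_sum (f := fun b => |(Sx t)⁻¹ (j t) b|) (fun _ _ => abs_nonneg _)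
        (Finset.mem_univ (j t))).trans (hM t (j t)))
    have h3 : 1 ≤ cmax * M t := by
      rw [← mul_one_div_cancel hcmax.ne']
      gcongr
      exact h1.trans h2
    rw [← mul_assoc]
    exact le_mul_of_one_le_left (Real.sqrt_nonneg _) h3
  refine tendstoInDistribution_of_close
    (Z := fun t ω => leadingTerm (Matrix.of (X t ω)) (Θhat t (X t ω)) (j t) (σε t) (ε t ω)) ?_ ?_ ?_
  · intro t
    have hXm := (hX t).measurable
    exact aemeasurable_studentized (β t) (j t)
      (fun i a => ((measurable_pi_apply a).comp ((measurable_pi_apply i).comp hXm)).aemeasurable)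
      (hε t).aemeasurable_apply (fun a b => ((hΘm t a b).comp hXm).aemeasurable)
      (fun a => (measurable_pi_apply a).comp_aemeasurable (hβhat t))
  · filter_upwards [hNpos] with t ht
    exact hasLaw_leadingTerm ht (hσε t) (hX t).measurable (hε t) (hXε t) (hΘm t) (j t)
  intro e he δ hδ
  -- There are five exceptional events, each allowed probability δ / 5.
  have hδ5 : 0 < δ / 5 := by positivity
  obtain ⟨q, hq0, hq⟩ := exists_two_mul_exp_neg_le hlog2 hδ5
  obtain ⟨q', hq'0, hq'⟩ := exists_two_mul_exp_neg_le one_pos hδ5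
  set τ := √((2 + q) * C₁) with hτ
  have hτ0 : 0 ≤ τ := Real.sqrt_nonneg _
  -- The larger score threshold, for dimensions up to K; the maximum with 2 lets the same A serve in
  -- both regimes.
  set x := max 2 √(2 * (1 + q)) with hx
  have hx2 : 2 ≤ x := le_max_left _ _
  set B := √(2 * q') with hB
  have hB0 : 0 ≤ B := Real.sqrt_nonneg _
  -- Dimension cutoff: n > K makes 2/n ≤ δ / 5.
  obtain ⟨K, hK⟩ := exists_nat_ge (2 / (δ / 5))
  set A := 6 * (√(2 * cmax) * x) + 3 * CLam with hA
  obtain ⟨η, hη0, hη1, hη2, hη3⟩ : ∃ η > 0, η ≤ u₃ ∧ η ≤ 1 / 4 ∧ 2 * (B * η) < e := by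
    have h1 : ∀ᶠ η in 𝓝[>] (0 : ℝ), η ≤ u₃ :=
      nhdsWithin_le_nhds (eventually_le_nhds hu₃)
    have h2 : ∀ᶠ η in 𝓝[>] (0 : ℝ), η ≤ 1 / 4 :=
      nhdsWithin_le_nhds (eventually_le_nhds (by norm_num))
    have h3 : ∀ᶠ η in 𝓝[>] (0 : ℝ), 2 * (B * η) < e := by
      have : Tendsto (fun η : ℝ => 2 * (B * η)) (𝓝[>] 0) (𝓝 0) := by
        have h : Tendsto (fun η : ℝ => 2 * (B * η)) (𝓝 0) (𝓝 (2 * (B * 0))) := by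
          apply Continuous.tendsto; fun_prop
        rw [mul_zero, mul_zero] at h
        exact h.mono_left nhdsWithin_le_nhds
      exact this.eventually_lt_const he
    obtain ⟨η, ⟨⟨ha, hb⟩, hc⟩, hd⟩ :=
      (((h1.and h2).and h3).and self_mem_nhdsWithin).exists
    exact ⟨η, hd, ha, hb, hc⟩
  -- Effective sparsity: at least n in dimensions up to K, equal to s₂ above. The added term is
  -- bounded by K, so s log n / √N still tends to zero.
  set s : ℕ → ℝ := fun t => s₂ t + if n t ≤ K then (n t : ℝ) else 0 with hsdef
  set κ : ℕ → ℝ := fun t => s t * Real.log (n t) / √(N t : ℝ) with hκdef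
  have hκ : Tendsto κ atTop (𝓝 0) := by
    have h1 : Tendsto (fun t => K * Real.log K / √(N t : ℝ)) atTop (𝓝 0) :=
      (Real.tendsto_sqrt_atTop.comp hNinf).const_div_atTop _
    have h2 : Tendsto (fun t => (if n t ≤ K then (n t : ℝ) else 0) * Real.log (n t) / √(N t : ℝ))
        atTop (𝓝 0) := by
      refine squeeze_zero (fun t => ?_) (fun t => ?_) h1
      · have := hlog2.le.trans (hlogn t)
        split_ifs <;> positivity
      · refine div_le_div_of_nonneg_right ?_ (Real.sqrt_nonneg _)
        split_ifs with h
        · have h3 : (n t : ℝ) ≤ K := by exact_mod_cast h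
          have h4 : (0 : ℝ) < n t := by exact_mod_cast hn0 t
          have := hlog2.le.trans (hlogn t)
          gcongr
        · rw [zero_mul]
          exact mul_nonneg (Nat.cast_nonneg _) (Real.log_natCast_nonneg _)
    have h3 := hgrowth.add h2
    rw [add_zero] at h3
    refine h3.congr fun t => ?_
    simp only [hκdef, hsdef]
    ring
  have ev_r : ∀ (a : ℝ) {b : ℝ}, 0 < b → ∀ᶠ t in atTop, a * √(Real.log (n t) / N t) < b := by
    intro a b hb
    have h := hr.const_mul a
    rw [mul_zero] at h
    exact h.eventually_lt_const hb
  have hsqκ : Tendsto (fun t => √(8 * κ t / cmin)) atTop (𝓝 0) := by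
    have h := ((hκ.const_mul 8).div_const cmin).sqrt
    simpa using h
  have ev₁ : ∀ᶠ t in atTop, 72 * τ * κ t < cmin / 2 := by
    have h := hκ.const_mul (72 * τ)
    rw [mul_zero] at h
    exact h.eventually_lt_const (by positivity)
  have ev₂ : ∀ᶠ t in atTop, A * √(8 * κ t / cmin) < 1 / 4 := by
    have h := hsqκ.const_mul A
    rw [mul_zero] at h
    exact h.eventually_lt_const (by norm_num)
  have ev₃ : ∀ᶠ t in atTop, 2 * (B * (A * √(8 * κ t / cmin) + η)
      + 24 * CMu * A * κ t / (cmin * √(1 / (8 * cmax)))) < e := by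
    have h := ((((hsqκ.const_mul A).add_const η).const_mul B).add
      ((hκ.const_mul (24 * CMu * A)).div_const (cmin * √(1 / (8 * cmax))))).const_mul 2
    simp only [mul_zero, zero_add, zero_div, add_zero] at h
    exact h.eventually_lt_const hη3
  have ev₄ : ∀ᶠ t in atTop, q' * 1 ≤ N t * η ^ 2 / C₃ := by
    have h : Tendsto (fun t => (N t : ℝ) * η ^ 2 / C₃) atTop atTop :=
      (hNinf.atTop_mul_const (by positivity)).atTop_div_const hC₃
    exact h.eventually_ge_atTop _
  filter_upwards [hNpos, ev_r τ hu₁, ev_r τ hcmax, ev_r √(3 * C₂) hu₂, ev_r CMu (b := 1 / 2)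
    (by norm_num), ev_r (τ * K) hcmin, ev₁, ev₂, ev₃, ev₄] with t ht e1 e2 e3 e4 e5 e6 e7 e8 e9
  have hsymm := (hX t).symm ht
  have hXm := (hX t).measurable
  have hr0 : 0 < √(Real.log (n t) / N t) := by
    have := hlog2.trans_le (hlogn t)
    exact Real.sqrt_pos.2 (by positivity)
  have hlam0 : 0 < lam t := lt_of_lt_of_le (by have := hσε t; positivity) (hlam t)
  have hmu0 : 0 ≤ mu t := le_trans (by positivity) (hmu t)
  have hqn : q * Real.log 2 ≤ q * Real.log (n t) := mul_le_mul_of_nonneg_left (hlogn t) hq0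
  have hbig : K < n t → 2 * Real.exp (-(1 * Real.log (n t))) ≤ δ / 5 := fun h => by
    have hnt : (0 : ℝ) < n t := by exact_mod_cast hn0 t
    have h1 : 2 / (δ / 5) ≤ n t := hK.trans (by exact_mod_cast h.le)
    rw [one_mul, Real.exp_neg, Real.exp_log hnt]
    rw [div_le_iff₀ hδ5] at h1
    rw [← div_eq_mul_inv, div_le_iff₀ hnt]
    linarith
  have hcov := (hcovB ht (hn0 t) (hX t) (τ := τ) (q := q) hτ0
    (Real.sq_sqrt (by positivity)).ge e1.le).trans (hq _ hqn)
  have hvar := (hvarB ht (hσε t) (hε t) hη0.le hη1).trans (hq' _ e9)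
  have hlead := (measureReal_abs_ge_le_of_hasLaw
    (hasLaw_leadingTerm ht (hσε t) hXm (hε t) (hXε t) (hΘm t) (j t)) hB0).trans
    (hq' _ (by rw [hB, Real.sq_sqrt (by positivity)]; linarith))
  have hfeas : (P t).real {ω | (∀ a a', |sampleCov (Matrix.of (X t ω)) a a' - Sx t a a'|
      ≤ τ * √(Real.log (n t) / N t)) ∧ ¬ ∃ Θ', ClimeFeasible (Matrix.of (X t ω)) (mu t) Θ'}
      ≤ δ / 5 := by
    rcases le_or_gt (n t) K with hnK | hnK
    · have hempty : {ω | (∀ a a', |sampleCov (Matrix.of (X t ω)) a a' - Sx t a a'|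
          ≤ τ * √(Real.log (n t) / N t)) ∧ ¬ ∃ Θ', ClimeFeasible (Matrix.of (X t ω)) (mu t) Θ'}
          = ∅ := by
        refine Set.eq_empty_of_forall_notMem fun ω hω => hω.2 ?_
        refine exists_climeFeasible_of_dim_le (le_quadratic_of_spectrum hsymm (hspec t)) hω.1
          (by positivity) (lt_of_le_of_lt ?_ e5) hmu0
        have : (n t : ℝ) ≤ K := by exact_mod_cast hnK
        calc τ * √(Real.log (n t) / N t) * n t ≤ τ * √(Real.log (n t) / N t) * K := by gcongr
          _ = _ := by ring
      rw [hempty, measureReal_empty]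
      exact hδ5.le
    · refine (measureReal_mono ?_).trans ((hclimeB ht (hn0 t) (hX t) (hspec t)
        (τ := √(3 * C₂)) (q := 1) (Real.sqrt_nonneg _)
        (by rw [Real.sq_sqrt (by positivity)]; linarith) e3.le).trans (hbig hnK))
      rintro ω ⟨-, hω⟩
      by_contra hnot
      refine hω ⟨(Sx t)⁻¹, fun a b => ?_⟩
      have : |((Sx t)⁻¹ * sampleCov (Matrix.of (X t ω)) - 1) a b|
          ≤ √(3 * C₂) * √(Real.log (n t) / N t) :=
        le_of_not_ge fun h => hnot ⟨a, b, h⟩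
      exact this.trans (hmu t)
  -- For n ≤ K the threshold y = x depends on δ and λ may fail to dominate the score, but n ≤ s
  -- compensates. For n > K the fixed y = 2 is what c_λ was built for.
  obtain ⟨y, hy0, hyx, hscore, hcase⟩ : ∃ y, 0 ≤ y ∧ y ≤ x ∧
      (P t).real {ω | ∃ a, y * √(Real.log (n t))
        ≤ |∑ i, unitWeight (fun i => Matrix.of (X t ω) i a) i * (ε t ω i / σε t)|} ≤ δ / 5 ∧
      (2 * (√(2 * cmax) * y * √(Real.log (n t) / N t) * σε t) ≤ lam t ∨ n t ≤ s t) := by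
    rcases le_or_gt (n t) K with hnK | hnK
    · refine ⟨x, by linarith, le_rfl, (measureReal_normalized_score_le ht (hn0 t) (hσε t) hXm (hε t)
        (hXε t) (by linarith) ?_).trans (hq _ hqn), Or.inr ?_⟩
      · have h1 : √(2 * (1 + q)) ^ 2 ≤ x ^ 2 := by gcongr; exact le_max_right _ _
        rw [Real.sq_sqrt (by positivity)] at h1
        linarith
      · simp only [hsdef, if_pos hnK]
        linarith [hs₂ t]
    · refine ⟨2, by norm_num, hx2, (measureReal_normalized_score_le ht (hn0 t) (hσε t) hXm (hε t)
        (hXε t) (by norm_num) (by norm_num)).trans (hbig hnK), Or.inl ?_⟩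
      refine le_trans (le_of_eq ?_) (hlam t)
      ring
  have hfin := measureReal_studentized_sub_leadingTerm_le (s := s t) (κ := κ t) (A := A) (B := B)
    (η := η) (e := e) (j := j t) ht (hn t) hcmin hcmax (hσε t) hν (hs₁ t) (hs₂ t) (hνs t) (hβ t)
    hlam0 (hlamC t) (hlamg t) (hmuC t) ((hmuC t).trans e4.le) (hlasso t) (hΘ t) hsymm (hspec t) hτ0
    e2.le hy0 (by simp only [hsdef]; split_ifs <;> simp) hcase
    (by rw [hA]; gcongr) rfl e6.le (by linarith) e8.le hcov hscore hfeas hvar hlead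
  linarith
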